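/- Let $N$ be a lattice (free abelian group of finite rank $r$), $M=\mathrm{Hom}_{\mathbb Z}(N,\mathbb Z)$, with natural pairing $m\cdot n$, also for $n\in N_{\mathbb R}=N\otimes\mathbb R$. Let $\Sigma$ be a (finite) complete rational polyhedral fan in $N_{\mathbb R}$, all of whose cones are strongly convex, and let $\deg\colon N\to\mathbb C$ be linear on (the lattice points of) every cone of $\Sigma$ (a degree function with respect to $\Sigma$), such that $\deg(d)\notin\mathbb Z$ for the primitive generator $d\in N$ of every one-dimensional cone of $\Sigma$. For $C\in\Sigma$, $m\in M$ and complex $q\neq 0$ let $$f_C(q,m)=\sum_{n\in C\cap N}q^{m\cdot n}e^{2\pi i\deg(n)}$$ if $m\cdot x>0$ for all $x\in C\smallsetminus\{0\}$ and $|q|$ is sufficiently small (depending on $m$); for other $(q,m)$, $f_C(q,m)$ is defined by analytic continuation, as the value at $(q,m)$ of the rational function in the monomials $q^{m\cdot n}$, $n\in N$, that represents these sums. Put $$r(q,m)=\sum_{C\in\Sigma}(-1)^{\operatorname{codim}C}f_C(q,m),\qquad f_{N,\deg}(q)=\sum_{m\in M}r(q,m).$$ Then the toric form $f_{N,\deg}$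 is well defined. More precisely, there exists $\varepsilon>0$ such that: (0) for all $C\in\Sigma$, $m\in M$ and $0<|q|<\varepsilon$, the rational function exists and is regular at $(q,m)$, and the value $f_C(q,m)$ is uniquely determined; (1) the sum $\sum_{m\in M}r(q,m)$ converges absolutely for each $q$ with $0<|q|<\varepsilon$, and uniformly on this set; (2) for each $m\in M$ there is a power series $\sum_{k\ge0}a_{m,k}q^k$ which converges to $r(q,m)$ for all $0<|q|<\varepsilon$, and for each $k\geq 0$ only finitely many $m\in M$ have $a_{m,k}\ne0$. Moreover, the construction does not depend on the fan: if $\Sigma'$ is another complete rational polyhedral fan satisfying the same hypotheses for the same function $\deg$, then there is $\delta>0$ such that for $0<|q|<\delta$ the functions $r(q,m)$ (for all $m\in M$) and $f_{N,\deg}(q)$ computed from $\Sigma$ and from $\Sigma'$ coincide. -/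

import Mathlib

open scoped TensorProduct

noncomputable section

namespace ToricForm

section

variable {N : Type*} [AddCommGroup N]

/-! ### Rational polyhedral cones and complete fans

`N` is a lattice (a free abelian group of finite rank), `M = Module.Dual ℤ N` is the dual lattice
and `N_ℝ = ℝ ⊗[ℤ] N`. -/

/-- The lattice point `n`, seen in `N_ℝ`. -/
def toReal (n : N) : ℝ ⊗[ℤ] N := (1 : ℝ) ⊗ₜ[ℤ] n

/-- The natural pairing `m · x` of `m ∈ M` with `x ∈ N_ℝ`. -/
def pairing (m : Module.Dual ℤ N) : ℝ ⊗[ℤ] N →ₗ[ℝ] ℝ :=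
  Module.Dual.baseChange ℝ m

/-- The pairing extends the natural pairing between `M` and `N`. -/
theorem pairing_toReal (m : Module.Dual ℤ N) (n : N) : pairing m (toReal n) = (m n : ℝ) := by
  simp [pairing, toReal]

/-- The set of `x` in `N_ℝ` with `m · x ≥ 0` for all `m` in the finite set `s`. -/
def polyCone (s : Finset (Module.Dual ℤ N)) : Set (ℝ ⊗[ℤ] N) :=
  {x | ∀ m ∈ s, 0 ≤ pairing m x}

/-- A rational polyhedral cone: cut out by finitely many integral inequalities, and containing
no line. -/
def IsRationalPolyhedralCone (C : Set (ℝ ⊗[ℤ] N)) : Prop :=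
  (∃ s : Finset (Module.Dual ℤ N), C = polyCone s) ∧ ∀ x ∈ C, -x ∈ C → x = 0

/-- `F` is a face of `C`: it is obtained by turning some of the inequalities that define `C`
into equalities. -/
def IsFace (F C : Set (ℝ ⊗[ℤ] N)) : Prop :=
  ∃ s t : Finset (Module.Dual ℤ N), t ⊆ s ∧ C = polyCone s ∧
    F = {x | x ∈ C ∧ ∀ m ∈ t, pairing m x = 0}

/-- A (finite) complete rational polyhedral fan in `N_ℝ`. -/
structure IsCompleteFan (Δ : Finset (Set (ℝ ⊗[ℤ] N))) : Prop where
  isCone : ∀ C ∈ Δ, IsRationalPolyhedralCone C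
  face_mem : ∀ C ∈ Δ, ∀ F, IsFace F C → F ∈ Δ
  inter_isFace : ∀ C ∈ Δ, ∀ C' ∈ Δ, IsFace (C ∩ C') C ∧ IsFace (C ∩ C') C'
  complete : ∀ x : ℝ ⊗[ℤ] N, ∃ C ∈ Δ, x ∈ C

/-- The dimension of a cone: the dimension of its linear span. -/
def coneDim (C : Set (ℝ ⊗[ℤ] N)) : ℕ := Module.finrank ℝ (Submodule.span ℝ C)

/-- The codimension of a cone in `N_ℝ`. -/
def coneCodim (C : Set (ℝ ⊗[ℤ] N)) : ℕ := Module.finrank ℤ N - coneDim C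

/-- The lattice points of a cone. -/
def latticePoints (C : Set (ℝ ⊗[ℤ] N)) : Set N := {n | toReal n ∈ C}

/-- `d` is the generator of a one-dimensional cone of `Δ`: the nonzero lattice point of which all
lattice points of the cone are multiples. -/
def IsRayGenerator (Δ : Finset (Set (ℝ ⊗[ℤ] N))) (d : N) : Prop :=
  ∃ C ∈ Δ, coneDim C = 1 ∧ d ≠ 0 ∧ d ∈ latticePoints C ∧
    ∀ n ∈ latticePoints C, ∃ k : ℕ, n = k • d

/-- `deg` is a degree function with respect to `Δ`: it is linear on every cone of `Δ`. -/
def IsDegreeFunction (Δ : Finset (Set (ℝ ⊗[ℤ] N))) (deg : N → ℂ) : Prop :=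
  ∀ C ∈ Δ, ∃ l : N →ₗ[ℤ] ℂ, ∀ n ∈ latticePoints C, deg n = l n

/-! ### The functions `f_C(q, m)`, `r(q, m)` and the toric form -/

/-- The term `q ^ (m · n) * exp (2 π i deg n)`. -/
def term (deg : N → ℂ) (q : ℂ) (m : Module.Dual ℤ N) (n : N) : ℂ :=
  q ^ (m n) * Complex.exp (2 * Real.pi * Complex.I * deg n)

/-- The value of the Laurent polynomial `P`, an element of the group ring `ℂ[N]` with monomials
`x ^ n`, at the point given by `x ^ n = q ^ (m · n)`. -/
def evalAt (q : ℂ) (m : Module.Dual ℤ N) (P : AddMonoidAlgebra ℂ N) : ℂ :=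
  P.coeff.sum fun n c => c * q ^ (m n)

/-- The rational function `P / Q` in the `q ^ (m · n)` represents the sum of `term` over the lattice
points of `C`: for every `m ∈ M` that is positive on `C` minus the origin and all sufficiently
small `q ≠ 0` (that is, `q = exp (2 π i τ)` with `τ` of sufficiently large imaginary part), the sum
converges absolutely, and its product with the value of `Q` is the value of `P`. -/
def RepresentsSum (C : Set (ℝ ⊗[ℤ] N)) (deg : N → ℂ) (P Q : AddMonoidAlgebra ℂ N) : Prop :=
  Q ≠ 0 ∧ ∀ m : Module.Dual ℤ N, (∀ x ∈ C, x ≠ 0 → 0 < pairing m x) →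
    ∃ δ : ℝ, 0 < δ ∧ ∀ q : ℂ, 0 < ‖q‖ → ‖q‖ < δ →
      Summable (fun n : latticePoints C => ‖term deg q m n‖) ∧
      evalAt q m Q * (∑' n : latticePoints C, term deg q m n) = evalAt q m P

/-- `v` is the value at `(q, m)` of the analytic continuation of the sum of `term` over the lattice
points of `C`, as a rational function in the `q ^ (m · n)` that is regular at `(q, m)`. -/
def IsContinuedValue (C : Set (ℝ ⊗[ℤ] N)) (deg : N → ℂ) (q : ℂ) (m : Module.Dual ℤ N)
    (v : ℂ) : Prop :=
  ∃ P Q : AddMonoidAlgebra ℂ N, RepresentsSum C deg P Q ∧ evalAt q m Q ≠ 0 ∧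
    v = evalAt q m P / evalAt q m Q

open Classical in
/-- `f_C(q, m)`; the default value `0` is used where the continuation is not regular. -/
def fCone (C : Set (ℝ ⊗[ℤ] N)) (deg : N → ℂ) (q : ℂ) (m : Module.Dual ℤ N) : ℂ :=
  if h : ∃ v, IsContinuedValue C deg q m v then h.choose else 0

/-- `r(q, m)`, the alternating sum of the `f_C(q, m)` over the cones of the fan. -/
def rTerm (Δ : Finset (Set (ℝ ⊗[ℤ] N))) (deg : N → ℂ) (q : ℂ) (m : Module.Dual ℤ N) : ℂ :=
  ∑ C ∈ Δ, (-1 : ℂ) ^ coneCodim C * fCone C deg q m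

/-- The toric form `f_{N,deg}`, as a function of `q = exp (2 π i τ)`. -/
def toricForm (Δ : Finset (Set (ℝ ⊗[ℤ] N))) (deg : N → ℂ) (q : ℂ) : ℂ :=
  ∑' m : Module.Dual ℤ N, rTerm Δ deg q m

/-- `deg` is a degree function for the complete fan `Δ` that takes no integral value at the
generators of the one-dimensional cones of `Δ`. -/
def IsAdmissible (Δ : Finset (Set (ℝ ⊗[ℤ] N))) (deg : N → ℂ) : Prop :=
  IsCompleteFan Δ ∧ IsDegreeFunction Δ deg ∧ ∀ d, IsRayGenerator Δ d → ∀ k : ℤ, deg d ≠ k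

end

end ToricForm

end

/-!
The proof computes in the group ring `ℂ[N]`, which acts on formal series `∑ g(n) x ^ n` given by
arbitrary functions `g : N → ℂ` (`act`). If Laurent polynomials `P` and `Q ≠ 0` satisfy
`Q • g = P`, then `g` is represented by the rational function `P / Q`, and this assignment is
linear in `g`. All denominators are products `∏ (1 - e(deg d) x ^ d)` over ray generators `d`
(`denom`), where `e(t) = exp (2 π i t)`; as `deg d` is not an integer, they do not vanish at
`x ^ n = q ^ (m · n)` for `0 < |q| < ε`, with `ε` independent of `m`.

For a cone `C` of the fan, the series of its lattice points becomes a Laurent polynomial after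
multiplication by `∏ (1 - x ^ d)` (`finite_support_act_denom`): far away from the origin, a lattice
point of `C` is far away from all facets that do not contain a suitable ray `d`, so that
translation by `d` does not affect membership. This gives the functions `f_C`, and they are unique
because the directions `m` that are positive on `C` separate the exponents of Laurent polynomials
(`isContinuedValue_iff`).

By Euler's relation, `∑ (-1) ^ codim C = 1` over the cones `C` of a complete fan that contain a
given point (`sum_neg_one_pow_coneCodim`). Hence the alternating sum `r(q, m)` is the value of the
rational function that represents the series `G` of all `e(deg n) x ^ n`, `n ∈ N`
(`rTerm_mul_evalAt_denom`). The series `G` does not involve the fan, which proves independence of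
the fan (`rTerm_eq_rTerm`).

It remains to see that `r(q, m) = O(q ^ (c |m|))`. Writing `G = P / Q`, this says that `P` has all
its exponents in the interior of the Newton polytope of `Q`, a zonotope. For a cone `C` let
`P_C / Q_C` represent its lattice points. The lattice points of `L N` in a translate `w + C` form
a dilate of the set of lattice points `n` with `n + w / L ∈ C`. Comparing the denominators
`∏ (1 - x ^ d)` and `∏ (1 - x ^ (L d))` bounds the exponents of the numerator of the latter set in
terms of those of `P_C` (`act_denom_dilate`). For `w = 0` and `L = 2` this forces the exponents of
`P_C` into the Newton polytope of `Q_C` (`neg_negPart_le_of_two_nsmul`); for other `w` it shows that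
the shifted cones satisfy a strict inequality in the directions `m` with `m · w < 0`
(`exists_numerator_shift`). For generic `w` and large `L` the cones shifted by `-w / L` partition
`N`, so that the strict inequality passes to `P` (`exists_numerator_total`). Finitely many `w`
suffice for all `m` (`exists_numerator_growth`), and expanding the factors of the denominator in
powers of `q` gives the orders and bounds (`exists_expansion`).
-/

noncomputable section

namespace ToricForm

/-! ### Laurent polynomials acting on formal series -/

section Action

variable {N : Type*} [AddCommGroup N]

/-- Multiplication of formal series: an element of the group ring `ℂ[N]` acts on a formal series
`∑ g(n) x ^ n`, encoded as its coefficient function `g : N → ℂ`; the monomial `x ^ k` translates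
the coefficients by `k`. -/
def act : AddMonoidAlgebra ℂ N →ₐ[ℂ] Module.End ℂ (N → ℂ) :=
  AddMonoidAlgebra.lift ℂ (Module.End ℂ (N → ℂ)) N
    { toFun := fun k => LinearMap.funLeft ℂ ℂ fun n => n - k.toAdd
      map_one' := by ext; simp
      map_mul' := fun a b => by
        ext g n
        simp only [LinearMap.funLeft_apply, Module.End.mul_apply, toAdd_mul]
        congr 1
        abel }

theorem act_single (k : N) (c : ℂ) (g : N → ℂ) (n : N) :
    act (AddMonoidAlgebra.single k c) g n = c * g (n - k) := by
  simp [act, AddMonoidAlgebra.lift_apply, LinearMap.funLeft_apply]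

theorem act_mul (P Q : AddMonoidAlgebra ℂ N) (g : N → ℂ) :
    act (P * Q) g = act P (act Q g) := by
  rw [map_mul]; rfl

theorem act_coeff (P R : AddMonoidAlgebra ℂ N) : act P R.coeff = (P * R).coeff := by
  induction P using AddMonoidAlgebra.induction_linear with
  | zero => ext; simp
  | add P P' h h' => ext; simp [add_mul, h, h']
  | single k c =>
    ext n
    rw [act_single, AddMonoidAlgebra.coeff_single_mul_eq_mul_coeff (n - k)]
    intro a _
    rw [eq_sub_iff_add_eq, add_comm]

/-- A function with finite support is the coefficient function of a Laurent polynomial. -/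
theorem exists_coeff_eq {N : Type*} {g : N → ℂ} (hg : (Function.support g).Finite) :
    ∃ P : AddMonoidAlgebra ℂ N, g = P.coeff :=
  ⟨.ofCoeff (Finsupp.ofSupportFinite g hg), rfl⟩

theorem act_one_sub_single (d : N) (c : ℂ) (g : N → ℂ) (n : N) :
    act (1 - AddMonoidAlgebra.single d c) g n = g n - c * g (n - d) := by
  simp [act_single]

/-- The common denominator `∏ (1 - z(d) x ^ d)` over a finite set of exponents `d`. -/
def denom (D : Finset N) (z : N → ℂ) : AddMonoidAlgebra ℂ N :=
  ∏ d ∈ D, (1 - AddMonoidAlgebra.single d (z d))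

/-- A character can be moved from the series into the denominator. -/
theorem act_denom_twist (D : Finset N) (χ : N → ℂ) (hχ : ∀ a b, χ (a + b) = χ a * χ b)
    (g : N → ℂ) (n : N) :
    act (denom D χ) (fun k => χ k * g k) n = χ n * act (denom D 1) g n := by
  classical
  unfold denom
  induction D using Finset.induction_on generalizing n with
  | empty => simp
  | insert d D hd ih =>
    rw [Finset.prod_insert hd, Finset.prod_insert hd, act_mul, act_mul, act_one_sub_single,
      act_one_sub_single, ih, ih]
    have := hχ d (n - d)
    rw [add_sub_cancel] at this
    rw [this, Pi.one_apply]
    ring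

theorem denom_mul_denom_sdiff [DecidableEq N] {D E : Finset N} (h : D ⊆ E) (z : N → ℂ) :
    denom (E \ D) z * denom D z = denom E z :=
  Finset.prod_sdiff h

theorem act_denom_eq_zero_of_forall_subset (D : Finset N) (g : N → ℂ) (n : N)
    (h : ∀ I ⊆ D, g (n - ∑ i ∈ I, i) = 0) : act (denom D 1) g n = 0 := by
  classical
  induction D using Finset.induction_on generalizing n with
  | empty => simpa [denom] using h ∅ (by simp)
  | insert d D hd ih =>
    rw [denom, Finset.prod_insert hd, act_mul, act_one_sub_single]
    have h1 := ih n fun I hI => h I (hI.trans (Finset.subset_insert _ _))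
    have h2 := ih (n - d) fun I hI => by
      have := h (insert d I) (Finset.insert_subset_insert _ hI)
      rwa [Finset.sum_insert (fun h => hd (hI h)), ← sub_sub] at this
    rw [denom] at h1 h2
    rw [h1, h2]; simp

/-- The alternating sum defining `denom D 1 • g` at `n` vanishes as soon as translation by one
element of `D` does not change the relevant values of `g`. -/
theorem act_denom_eq_zero_of_shift [DecidableEq N] (D : Finset N) {d : N} (hd : d ∈ D)
    (g : N → ℂ) (n : N)
    (h : ∀ I ⊆ D.erase d, g (n - ∑ i ∈ I, i) = g (n - ∑ i ∈ I, i - d)) :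
    act (denom D 1) g n = 0 := by
  have : denom D 1 = denom (D.erase d) 1 * (1 - AddMonoidAlgebra.single d (1 : ℂ)) := by
    rw [denom, ← Finset.mul_prod_erase D _ hd, mul_comm]; rfl
  rw [this, act_mul]
  refine act_denom_eq_zero_of_forall_subset _ _ _ fun I hI => ?_
  rw [act_one_sub_single, h I hI]; simp

end Action

/-! ### The factors `exp (2 π i deg n)` -/

section ExpDeg

variable {N : Type*}

/-- The factor `exp (2 π i deg n)` of the terms. -/
def expDeg (deg : N → ℂ) (n : N) : ℂ := Complex.exp (2 * Real.pi * Complex.I * deg n)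

theorem expDeg_ne_zero (deg : N → ℂ) (n : N) : expDeg deg n ≠ 0 := Complex.exp_ne_zero _

theorem expDeg_ne_one {deg : N → ℂ} {n : N} (h : ∀ k : ℤ, deg n ≠ k) : expDeg deg n ≠ 1 := by
  intro h1
  obtain ⟨k, hk⟩ := Complex.exp_eq_one_iff.1 h1
  refine h k (mul_left_cancel₀ Complex.two_pi_I_ne_zero ?_)
  rw [hk, mul_comm]

theorem expDeg_linear_add [AddCommGroup N] (l : N →ₗ[ℤ] ℂ) (a b : N) :
    expDeg l (a + b) = expDeg l a * expDeg l b := by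
  rw [expDeg, map_add, mul_add, Complex.exp_add]; rfl

end ExpDeg

/-! ### Lower bounds for exponents -/

section Bounds

variable {N : Type*} [AddCommGroup N]

/-- Minus the least value of `m` on the Newton polytope of `∏ (1 - z(d) x ^ d)`, the zonotope
spanned by `D`. -/
def negPart (D : Finset N) (m : Module.Dual ℤ N) : ℤ := ∑ d ∈ D, max 0 (-(m d))

theorem negPart_sdiff_add [DecidableEq N] {D E : Finset N} (h : D ⊆ E) (m : Module.Dual ℤ N) :
    negPart (E \ D) m + negPart D m = negPart E m :=
  Finset.sum_sdiff h

theorem prod_zpow_max {q : ℂ} (hq : q ≠ 0) (D : Finset N) (m : Module.Dual ℤ N) :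
    ∏ d ∈ D, q ^ max 0 (-(m d)) = q ^ negPart D m := by
  classical
  unfold negPart
  induction D using Finset.induction_on with
  | empty => simp
  | insert d D hd ih => rw [Finset.prod_insert hd, Finset.sum_insert hd, ih, zpow_add₀ hq]

theorem exists_add_of_coeff_mul_ne_zero {P R : AddMonoidAlgebra ℂ N} {n : N}
    (h : (P * R).coeff n ≠ 0) : ∃ a b, P.coeff a ≠ 0 ∧ R.coeff b ≠ 0 ∧ n = a + b := by
  classical
  by_contra! hc
  apply h
  rw [AddMonoidAlgebra.coeff_mul]
  refine Finset.sum_eq_zero fun a ha => Finset.sum_eq_zero fun b hb => if_neg fun hab => ?_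
  exact hc a b (Finsupp.mem_support_iff.1 ha) (Finsupp.mem_support_iff.1 hb) hab.symm

theorem le_of_coeff_prod_ne_zero {ι : Type*} (s : Finset ι) (P : ι → AddMonoidAlgebra ℂ N)
    (m : Module.Dual ℤ N) (β : ι → ℤ) (h : ∀ i ∈ s, ∀ n, (P i).coeff n ≠ 0 → β i ≤ m n) {n : N}
    (hn : (∏ i ∈ s, P i).coeff n ≠ 0) : ∑ i ∈ s, β i ≤ m n := by
  classical
  induction s using Finset.induction_on generalizing n with
  | empty =>
    have : n = 0 := by
      by_contra h0
      apply hn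
      simp [AddMonoidAlgebra.one_def, Ne.symm h0]
    simp [this]
  | insert i s hi ih =>
    rw [Finset.prod_insert hi] at hn
    obtain ⟨a, b, ha, hb, rfl⟩ := exists_add_of_coeff_mul_ne_zero hn
    rw [Finset.sum_insert hi, map_add]
    exact add_le_add (h i (by simp) a ha)
      (ih (fun j hj => h j (Finset.mem_insert_of_mem hj)) hb)

theorem neg_negPart_le_of_coeff_denom_ne_zero (D : Finset N) (z : N → ℂ) (m : Module.Dual ℤ N)
    {n : N} (hn : (denom D z).coeff n ≠ 0) : -negPart D m ≤ m n := by
  rw [negPart, ← Finset.sum_neg_distrib]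
  refine le_of_coeff_prod_ne_zero D _ m _ (fun d _ k hk => ?_) hn
  have : k = 0 ∨ k = d := by
    by_contra! hc
    apply hk
    simp [AddMonoidAlgebra.one_def, hc.1.symm, hc.2.symm]
  rcases this with rfl | rfl
  · simp
  · grind

/-- The quotient `∏ (1 - x ^ (L d)) / ∏ (1 - x ^ d)`. -/
def geomFactor (D : Finset N) (L : ℕ) : AddMonoidAlgebra ℂ N :=
  ∏ d ∈ D, ∑ j ∈ Finset.range L, AddMonoidAlgebra.single (j • d) (1 : ℂ)

theorem geomFactor_mul_denom (D : Finset N) (L : ℕ) :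
    geomFactor D L * denom D 1 = ∏ d ∈ D, (1 - AddMonoidAlgebra.single (L • d) (1 : ℂ)) := by
  rw [geomFactor, denom, ← Finset.prod_mul_distrib]
  refine Finset.prod_congr rfl fun d _ => ?_
  have := geom_sum_mul_neg (AddMonoidAlgebra.single d (1 : ℂ)) L
  simpa [AddMonoidAlgebra.single_pow] using this

theorem le_of_coeff_geomFactor_ne_zero (D : Finset N) {L : ℕ} (m : Module.Dual ℤ N)
    {n : N} (hn : (geomFactor D L).coeff n ≠ 0) : -((L - 1 : ℤ) * negPart D m) ≤ m n := by
  rw [negPart, Finset.mul_sum, ← Finset.sum_neg_distrib]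
  refine le_of_coeff_prod_ne_zero D _ m _ (fun d _ k hk => ?_) hn
  obtain ⟨j, hj, rfl⟩ : ∃ j < L, k = j • d := by
    by_contra! hc
    apply hk
    simp only [AddMonoidAlgebra.coeff_sum, AddMonoidAlgebra.coeff_single, Finsupp.coe_finsetSum,
      Finset.sum_apply]
    refine Finset.sum_eq_zero fun j hj => ?_
    exact Finsupp.single_eq_of_ne (hc j (Finset.mem_range.1 hj))
  rw [map_nsmul, nsmul_eq_mul]
  have h1 : (j : ℤ) ≤ L - 1 := by omega
  have h2 : (0 : ℤ) ≤ j := by positivity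
  rcases le_total 0 (m d) with h | h
  · rw [max_eq_left (by omega)]; nlinarith
  · rw [max_eq_right (by omega)]; nlinarith

/-- Restriction of the exponents to the sublattice `L N` intertwines multiplication by
`1 - x ^ (L d)` and by `1 - x ^ d`. -/
theorem act_prod_apply_smul (D : Finset N) (L : ℕ) (g : N → ℂ) (n : N) :
    act (∏ d ∈ D, (1 - AddMonoidAlgebra.single (L • d) (1 : ℂ))) g (L • n) =
      act (denom D 1) (fun k => g (L • k)) n := by
  classical
  unfold denom
  induction D using Finset.induction_on generalizing n with
  | empty => simp
  | insert d D hd ih =>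
    rw [Finset.prod_insert hd, Finset.prod_insert hd, act_mul, act_mul, act_one_sub_single,
      act_one_sub_single, ih, ← smul_sub, ih, Pi.one_apply]

/-- The numerator of the series of `n ↦ g (L n + w)` in terms of that of `g`: compare the
denominators `∏ (1 - x ^ d)` and `∏ (1 - x ^ (L d))` and restrict the exponents to `L N`. -/
theorem act_denom_dilate (D : Finset N) (g : N → ℂ) (P : AddMonoidAlgebra ℂ N)
    (hP : act (denom D 1) g = P.coeff) (L : ℕ) (w n : N) :
    act (denom D 1) (fun k => g (L • k + w)) n =
      (geomFactor D L * (AddMonoidAlgebra.single (-w) 1 * P)).coeff (L • n) := by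
  have h1 : (fun k => g (L • k + w)) =
      fun k => (act (AddMonoidAlgebra.single (-w) (1 : ℂ)) g) (L • k) := by
    funext k; rw [act_single]; simp
  rw [h1, ← act_prod_apply_smul, ← geomFactor_mul_denom, act_mul, ← act_mul (denom D 1),
    mul_comm (denom D 1), act_mul, hP, act_coeff, act_coeff]

theorem le_of_dilate_ne_zero (D : Finset N) (P : AddMonoidAlgebra ℂ N) (m : Module.Dual ℤ N)
    {β : ℤ} (hβ : ∀ n, P.coeff n ≠ 0 → β ≤ m n) {L : ℕ} (w : N) {n : N}
    (hn : (geomFactor D L * (AddMonoidAlgebra.single (-w) 1 * P)).coeff (L • n) ≠ 0) :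
    -((L - 1 : ℤ) * negPart D m) - m w + β ≤ L * m n := by
  obtain ⟨a, b, ha, hb, hab⟩ := exists_add_of_coeff_mul_ne_zero hn
  obtain ⟨c, e, hc, he, rfl⟩ := exists_add_of_coeff_mul_ne_zero hb
  have hcw : c = -w := by
    by_contra h0
    apply hc
    simp [Ne.symm h0]
  subst hcw
  have h1 := le_of_coeff_geomFactor_ne_zero D m ha
  have h2 := hβ e he
  have h3 := congrArg m hab
  simp only [map_nsmul, nsmul_eq_mul, map_add, map_neg] at h3
  rw [h3]; linarith

/-- If the series `g` is unchanged by passing to the exponents in `2 N`, then all exponents `n` of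
its numerator satisfy `m · n ≥ - negPart D m`: the numerator lies in the Newton polytope of the
denominator. -/
theorem neg_negPart_le_of_two_nsmul (D : Finset N) (g : N → ℂ) (hg : ∀ n, g (2 • n) = g n)
    (P : AddMonoidAlgebra ℂ N) (hP : act (denom D 1) g = P.coeff) (m : Module.Dual ℤ N) {n : N}
    (hn : P.coeff n ≠ 0) : -negPart D m ≤ m n := by
  obtain ⟨n₀, hn₀, hmin⟩ := P.coeff.support.exists_min_image m ⟨n, by simpa using hn⟩
  have hmin' : ∀ k, P.coeff k ≠ 0 → m n₀ ≤ m k := fun k hk => hmin k (by simpa using hk)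
  have h := act_denom_dilate D g P hP 2 0 n₀
  simp only [add_zero, hg] at h
  rw [hP] at h
  have h1 := le_of_dilate_ne_zero D P m hmin' (L := 2) 0 (n := n₀)
    (by rw [← h]; simpa using hn₀)
  have h2 := hmin' n hn
  push_cast at h1
  rw [map_zero] at h1
  linarith

end Bounds

/-! ### Rational cones are generated by their rays -/

section Pairing

variable {N : Type*} [AddCommGroup N]

theorem pairing_add_left (m m' : Module.Dual ℤ N) (x : ℝ ⊗[ℤ] N) :
    pairing (m + m') x = pairing m x + pairing m' x := by
  induction x using TensorProduct.induction_on with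
  | zero => simp
  | tmul a n => simp [pairing]
  | add x y hx hy => simp only [map_add, hx, hy]; ring

theorem pairing_zero_left (x : ℝ ⊗[ℤ] N) : pairing (0 : Module.Dual ℤ N) x = 0 := by
  simpa using pairing_add_left (0 : Module.Dual ℤ N) 0 x

theorem pairing_sum_left {ι : Type*} (s : Finset ι) (f : ι → Module.Dual ℤ N) (x : ℝ ⊗[ℤ] N) :
    pairing (∑ i ∈ s, f i) x = ∑ i ∈ s, pairing (f i) x := by
  classical
  induction s using Finset.induction_on with
  | empty => simp [pairing_zero_left]
  | insert i s hi ih => rw [Finset.sum_insert hi, Finset.sum_insert hi, pairing_add_left, ih]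

theorem pairing_baseChange {N' : Type*} [AddCommGroup N'] (f : N →ₗ[ℤ] N') (m : Module.Dual ℤ N')
    (x : ℝ ⊗[ℤ] N) : pairing m (f.lTensor ℝ x) = pairing (m ∘ₗ f) x := by
  induction x using TensorProduct.induction_on with
  | zero => simp
  | tmul a n => simp [pairing]
  | add x y hx hy => simp only [map_add, hx, hy]

theorem eq_zero_of_pairing_coord {ι : Type*} (b : Module.Basis ι ℤ N) {x : ℝ ⊗[ℤ] N}
    (h : ∀ i, pairing (b.coord i) x = 0) : x = 0 := by
  have key : ∀ (i : ι) (x : ℝ ⊗[ℤ] N),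
      (Algebra.TensorProduct.basis ℝ b).repr x i = pairing (b.coord i) x := by
    intro i x
    induction x using TensorProduct.induction_on with
    | zero => simp
    | tmul a n => simp [pairing, Algebra.TensorProduct.basis_repr_tmul, mul_comm]
    | add x y hx hy => simp only [map_add, Finsupp.add_apply, hx, hy]
  rw [← (Algebra.TensorProduct.basis ℝ b).repr.map_eq_zero_iff]
  ext i
  rw [key, h]; rfl

theorem toReal_eq_zero [Module.Free ℤ N] {n : N} (h : toReal n = 0) : n = 0 := by
  let b := Module.Free.chooseBasis ℤ N
  rw [← b.repr.map_eq_zero_iff]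
  ext i
  have := pairing_toReal (b.coord i) n
  rw [h, map_zero] at this
  exact_mod_cast this.symm

theorem mem_latticePoints_polyCone {s : Finset (Module.Dual ℤ N)} {n : N} :
    n ∈ latticePoints (polyCone s) ↔ ∀ m ∈ s, 0 ≤ m n := by
  simp [latticePoints, polyCone, pairing_toReal]

/-- A functional that is positive on a strongly convex cone minus the origin: the sum of the
inequalities that define the cone. -/
theorem IsRationalPolyhedralCone.exists_pos {C : Set (ℝ ⊗[ℤ] N)}
    (hC : IsRationalPolyhedralCone C) :
    ∃ h : Module.Dual ℤ N, ∀ x ∈ C, x ≠ 0 → 0 < pairing h x := by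
  obtain ⟨⟨s, rfl⟩, hline⟩ := hC
  refine ⟨∑ m ∈ s, m, fun x hx hx0 => ?_⟩
  rw [pairing_sum_left]
  refine lt_of_le_of_ne (Finset.sum_nonneg hx) fun h0 => hx0 (hline x hx fun m hm => ?_)
  rw [map_neg, (Finset.sum_eq_zero_iff_of_nonneg hx).1 h0.symm m hm, neg_zero]

/-- From `x` in a cone, move along `y` until a further inequality becomes an equality. -/
theorem exists_add_smul_mem_polyCone {s : Finset (Module.Dual ℤ N)} {x y : ℝ ⊗[ℤ] N}
    (hx : x ∈ polyCone s) (hy : y ∉ polyCone s)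
    (hxy : ∀ m ∈ s, pairing m x = 0 → pairing m y = 0) :
    ∃ t : ℝ, 0 < t ∧ x + t • y ∈ polyCone s ∧
      {m ∈ s | 0 < pairing m (x + t • y)} ⊂ {m ∈ s | 0 < pairing m x} := by
  classical
  have hne : {m ∈ s | pairing m y < 0}.Nonempty := by
    by_contra h
    rw [Finset.not_nonempty_iff_eq_empty, Finset.filter_eq_empty_iff] at h
    exact hy fun m hm => not_lt.1 (h hm)
  obtain ⟨m₀, hm₀, hmin⟩ :=
    Finset.exists_min_image _ (fun m => pairing m x / -pairing m y) hne
  rw [Finset.mem_filter] at hm₀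
  have hm₀x : 0 < pairing m₀ x :=
    lt_of_le_of_ne (hx m₀ hm₀.1) fun h => hm₀.2.ne (hxy m₀ hm₀.1 h.symm)
  have hneg : 0 < -pairing m₀ y := neg_pos.2 hm₀.2
  refine ⟨pairing m₀ x / -pairing m₀ y, by positivity, fun m hm => ?_, ?_⟩
  · rw [map_add, map_smul, smul_eq_mul]
    rcases lt_or_ge (pairing m y) 0 with h | h
    · have := hmin m (by simp [hm, h])
      rw [le_div_iff₀ (neg_pos.2 h)] at this
      linarith
    · have := hx m hm
      positivity
  · refine Finset.ssubset_iff_subset_ne.2 ⟨fun m hm => ?_, fun h => ?_⟩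
    · rw [Finset.mem_filter] at hm ⊢
      refine ⟨hm.1, lt_of_le_of_ne (hx m hm.1) fun h => ?_⟩
      rw [map_add, map_smul, hxy m hm.1 h.symm, ← h] at hm
      simp at hm
    · have : m₀ ∈ ({m ∈ s | 0 < pairing m x} : Finset _) := by simp [hm₀.1, hm₀x]
      rw [← h, Finset.mem_filter, map_add, map_smul, smul_eq_mul] at this
      have h2 : pairing m₀ x / -pairing m₀ y * pairing m₀ y = -pairing m₀ x := by
        field_simp [hm₀.2.ne]
      linarith [this.2]

/-- A solution of a homogeneous system of integral equations in `N_ℝ` gives a solution in `N`. -/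
theorem exists_lattice_solution [Module.Free ℤ N] (t : Finset (Module.Dual ℤ N)) {x : ℝ ⊗[ℤ] N}
    (hx0 : x ≠ 0) (hx : ∀ m ∈ t, pairing m x = 0) : ∃ n : N, n ≠ 0 ∧ ∀ m ∈ t, m n = 0 := by
  by_contra! hc
  let f : N →ₗ[ℤ] (t → ℤ) := LinearMap.pi fun m => m.1
  have hf : Function.Injective f := by
    rw [injective_iff_map_eq_zero]
    intro n hn
    by_contra h0
    obtain ⟨m, hm, hmn⟩ := hc n h0
    exact hmn (congrFun hn ⟨m, hm⟩)
  have := Module.Flat.lTensor_preserves_injective_linearMap (M := ℝ) f hf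
  rw [injective_iff_map_eq_zero] at this
  refine hx0 (this x (eq_zero_of_pairing_coord (Pi.basisFun ℤ t) fun m => ?_))
  rw [pairing_baseChange]
  have : (Pi.basisFun ℤ t).coord m ∘ₗ f = m.1 := by ext; simp [f]
  rw [this, hx m m.2]

end Pairing

section Rays

variable {N : Type*} [AddCommGroup N] {Δ : Finset (Set (ℝ ⊗[ℤ] N))}

theorem IsRayGenerator.ne_zero {d : N} (h : IsRayGenerator Δ d) : d ≠ 0 := by
  obtain ⟨-, -, -, h, -⟩ := h; exact h

theorem finite_isRayGenerator [Module.Free ℤ N] (Δ : Finset (Set (ℝ ⊗[ℤ] N))) :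
    {d | IsRayGenerator Δ d}.Finite := by
  have hsub : {d | IsRayGenerator Δ d} ⊆ ⋃ C ∈ Δ, {d | d ≠ 0 ∧ d ∈ latticePoints C ∧
      ∀ n ∈ latticePoints C, ∃ k : ℕ, n = k • d} := by
    rintro d ⟨C, hC, -, h⟩
    exact Set.mem_biUnion hC h
  refine (Set.Finite.biUnion Δ.finite_toSet fun C _ => Set.Subsingleton.finite ?_).subset hsub
  rintro d ⟨hd0, hd, hd'⟩ e ⟨he0, he, he'⟩
  obtain ⟨k, hk⟩ := he' d hd
  obtain ⟨l, hl⟩ := hd' e he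
  have h1 : (1 - (k * l : ℤ)) • d = 0 := by
    rw [sub_smul, one_smul, sub_eq_zero, mul_smul, natCast_zsmul, natCast_zsmul, ← hl, ← hk]
  have h2 : (k * l : ℤ) = 1 := by
    rcases smul_eq_zero.1 h1 with h | h
    · omega
    · exact absurd h hd0
  have h3 : k * l = 1 := by exact_mod_cast h2
  rw [hk, Nat.eq_one_of_mul_eq_one_right h3, one_smul]

/-- The generators of the one-dimensional cones of the fan. -/
def rays [Module.Free ℤ N] (Δ : Finset (Set (ℝ ⊗[ℤ] N))) : Finset N :=
  (finite_isRayGenerator Δ).toFinset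

open Classical in
/-- The generators of the one-dimensional cones of the fan that lie in `C`. -/
def raysIn [Module.Free ℤ N] (Δ : Finset (Set (ℝ ⊗[ℤ] N))) (C : Set (ℝ ⊗[ℤ] N)) : Finset N :=
  {d ∈ rays Δ | d ∈ latticePoints C}

variable [Module.Free ℤ N]

theorem mem_rays {d : N} : d ∈ rays Δ ↔ IsRayGenerator Δ d := by simp [rays]

theorem mem_raysIn {C : Set (ℝ ⊗[ℤ] N)} {d : N} :
    d ∈ raysIn Δ C ↔ IsRayGenerator Δ d ∧ d ∈ latticePoints C := by
  classical
  simp [raysIn, mem_rays]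

theorem raysIn_subset (C : Set (ℝ ⊗[ℤ] N)) : raysIn Δ C ⊆ rays Δ := by
  classical
  exact Finset.filter_subset _ _

/-- The case of a minimal face: if `x` spans a face of `C`, then it is a multiple of a ray
generator. -/
theorem exists_rayGenerator_of_line (hΔ : IsCompleteFan Δ) {s : Finset (Module.Dual ℤ N)}
    (hC : polyCone s ∈ Δ) {h : Module.Dual ℤ N} {x : ℝ ⊗[ℤ] N}
    (hh : ∀ x ∈ polyCone s, x ≠ 0 → 0 < pairing h x) (hx : x ∈ polyCone s) (hx0 : x ≠ 0)
    (hline : ∀ y, (∀ m ∈ s, pairing m x = 0 → pairing m y = 0) → pairing h y = 0 → y = 0) :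
    ∃ d ∈ raysIn Δ (polyCone s), ∃ c : ℝ, 0 ≤ c ∧ x = c • toReal d := by
  classical
  set t : Finset (Module.Dual ℤ N) := {m ∈ s | pairing m x = 0} with ht
  have hhx := hh x hx hx0
  have hh0 : ∀ y ∈ polyCone s, 0 ≤ pairing h y := fun y hy => by
    rcases eq_or_ne y 0 with rfl | hy0
    · simp
    · exact (hh y hy hy0).le
  have hmul : ∀ y, (∀ m ∈ t, pairing m y = 0) → y = (pairing h y / pairing h x) • x := by
    intro y hy
    refine sub_eq_zero.1 (hline _ (fun m hm hmx => ?_) ?_)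
    · rw [map_sub, map_smul, hy m (by simp [ht, hm, hmx]), hmx]; simp
    · rw [map_sub, map_smul, smul_eq_mul, div_mul_cancel₀ _ hhx.ne', sub_self]
  have hmulN : ∀ n : N, (∀ m ∈ t, m n = 0) → toReal n = ((h n : ℝ) / pairing h x) • x := by
    intro n hn
    have := hmul (toReal n) fun m hm => by rw [pairing_toReal, hn m hm]; simp
    rwa [pairing_toReal] at this
  have hzero : ∀ n : N, (∀ m ∈ t, m n = 0) → h n = 0 → n = 0 := by
    intro n hn hh
    apply toReal_eq_zero
    rw [hmulN n hn, hh]; simp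
  have hex : ∃ k : ℕ, 0 < k ∧ ∃ n : N, (∀ m ∈ t, m n = 0) ∧ h n = k := by
    obtain ⟨n, hn0, hn⟩ := exists_lattice_solution t hx0 fun m hm => (Finset.mem_filter.1 hm).2
    have hh : h n ≠ 0 := fun hh => hn0 (hzero n hn hh)
    rcases lt_or_gt_of_ne hh with hh | hh
    · exact ⟨(-h n).toNat, by omega, -n, fun m hm => by simp [hn m hm], by simp; omega⟩
    · exact ⟨(h n).toNat, by omega, n, hn, by omega⟩
  obtain ⟨hkpos, d, hd, hdk⟩ := Nat.find_spec hex
  set k := Nat.find hex with hk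
  have hkR : (0 : ℝ) < k := by exact_mod_cast hkpos
  have hdR : toReal d = ((k : ℝ) / pairing h x) • x := by rw [hmulN d hd, hdk]; simp
  let F : Set (ℝ ⊗[ℤ] N) := {y | y ∈ polyCone s ∧ ∀ m ∈ t, pairing m y = 0}
  have hF : F ∈ Δ := hΔ.face_mem _ hC F ⟨s, t, Finset.filter_subset _ _, rfl, rfl⟩
  have hxF : x ∈ F := ⟨hx, fun m hm => (Finset.mem_filter.1 hm).2⟩
  have hsmul : ∀ c : ℝ, 0 ≤ c → c • x ∈ F := fun c hc =>
    ⟨fun m hm => by rw [map_smul]; exact mul_nonneg hc (hx m hm),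
      fun m hm => by rw [map_smul, hxF.2 m hm, smul_zero]⟩
  have hdF : d ∈ latticePoints F := by
    change toReal d ∈ F
    rw [hdR]; exact hsmul _ (by positivity)
  refine ⟨d, mem_raysIn.2 ⟨⟨F, hF, ?_, ?_, hdF, fun n hn => ?_⟩, hdF.1⟩,
    pairing h x / k, by positivity, ?_⟩
  · have : Submodule.span ℝ F = Submodule.span ℝ {x} := by
      refine le_antisymm (Submodule.span_le.2 fun y hy => ?_)
        (Submodule.span_mono (Set.singleton_subset_iff.2 hxF))
      rw [hmul y hy.2]
      exact Submodule.smul_mem _ _ (Submodule.mem_span_singleton_self x)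
    rw [coneDim, this, finrank_span_singleton hx0]
  · rintro rfl
    rw [map_zero] at hdk
    omega
  · have hnt : ∀ m ∈ t, m n = 0 := fun m hm => by
      have := hn.2 m hm
      rw [pairing_toReal] at this
      exact_mod_cast this
    have hn0 : 0 ≤ h n := by
      have := hh0 _ hn.1
      rw [pairing_toReal] at this
      exact_mod_cast this
    refine ⟨(h n / k).toNat, sub_eq_zero.1 (hzero _ (fun m hm => ?_) ?_)⟩
    · rw [map_sub, map_nsmul, hnt m hm, hd m hm]; simp
    · have hq : 0 ≤ h n / k := Int.ediv_nonneg hn0 (by positivity)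
      have hval : h (n - (h n / k).toNat • d) = h n % k := by
        rw [map_sub, map_nsmul, hdk, nsmul_eq_mul, Int.toNat_of_nonneg hq, Int.emod_def]
        ring
      rw [hval]
      by_contra hne
      have hmod0 := Int.emod_nonneg (h n) (b := (k : ℤ)) (by omega)
      have hmodlt := Int.emod_lt_of_pos (h n) (b := (k : ℤ)) (by omega)
      refine Nat.find_min hex (m := (h n % k).toNat) (by omega)
        ⟨by omega, n - (h n / k).toNat • d, fun m hm => ?_, by rw [hval]; omega⟩
      rw [map_sub, map_nsmul, hnt m hm, hd m hm]; simp
  · rw [hdR, smul_smul]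
    rw [div_mul_div_comm, mul_comm, div_self (by positivity), one_smul]

/-- Every point of a cone of the fan is a nonnegative combination of ray generators. -/
theorem exists_eq_sum_rays (hΔ : IsCompleteFan Δ) {C : Set (ℝ ⊗[ℤ] N)} (hC : C ∈ Δ)
    {x : ℝ ⊗[ℤ] N} (hx : x ∈ C) :
    ∃ t : N → ℝ, (∀ d, 0 ≤ t d) ∧ x = ∑ d ∈ raysIn Δ C, t d • toReal d := by
  classical
  obtain ⟨h, hh⟩ := (hΔ.isCone C hC).exists_pos
  obtain ⟨⟨s, rfl⟩, hconv⟩ := hΔ.isCone C hC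
  induction hn : ({m ∈ s | 0 < pairing m x} : Finset _).card using Nat.strong_induction_on
    generalizing x with
  | _ n ih =>
    subst hn
    by_cases hx0 : x = 0
    · exact ⟨0, fun _ => le_rfl, by simp [hx0]⟩
    by_cases hline :
        ∀ y, (∀ m ∈ s, pairing m x = 0 → pairing m y = 0) → pairing h y = 0 → y = 0
    · obtain ⟨d, hd, c, hc, rfl⟩ := exists_rayGenerator_of_line hΔ hC hh hx hx0 hline
      refine ⟨Pi.single d c, fun e => ?_, ?_⟩
      · rcases eq_or_ne e d with rfl | he
        · simpa using hc
        · simp [he]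
      · rw [Finset.sum_eq_single_of_mem d hd fun e _ he => by simp [he]]; simp
    · push Not at hline
      obtain ⟨y, hy, hhy, hy0⟩ := hline
      have hyC : y ∉ polyCone s := fun hyC => (hh y hyC hy0).ne' hhy
      have hyC' : -y ∉ polyCone s := fun hyC =>
        (hh (-y) hyC (neg_ne_zero.2 hy0)).ne' (by rw [map_neg, hhy, neg_zero])
      obtain ⟨a, ha, ha', haC⟩ := exists_add_smul_mem_polyCone hx hyC hy
      obtain ⟨b, hb, hb', hbC⟩ := exists_add_smul_mem_polyCone hx hyC' fun m hm hmx => by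
        rw [map_neg, hy m hm hmx, neg_zero]
      obtain ⟨t, ht, hxt⟩ := ih _ (Finset.card_lt_card haC) ha' rfl
      obtain ⟨u, hu, hxu⟩ := ih _ (Finset.card_lt_card hbC) hb' rfl
      refine ⟨fun d => b / (a + b) * t d + a / (a + b) * u d, fun d => ?_, ?_⟩
      · have := ht d
        have := hu d
        positivity
      · simp only [add_smul, mul_smul, Finset.sum_add_distrib, ← Finset.smul_sum]
        rw [← hxt, ← hxu]
        have hab : b / (a + b) + a / (a + b) = 1 := by field_simp; ring
        calc x = (b / (a + b) + a / (a + b)) • x := by rw [hab, one_smul]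
          _ = _ := by module

end Rays

/-! ### The rational function of a cone -/

section Numerators

variable {N : Type*} [AddCommGroup N] [Module.Free ℤ N] {Δ : Finset (Set (ℝ ⊗[ℤ] N))}

/-- On the lattice points of a cone of the fan, every functional is dominated by any
functional `h` that is positive on the cone. -/
theorem exists_abs_le_mul (hΔ : IsCompleteFan Δ) {C : Set (ℝ ⊗[ℤ] N)} (hC : C ∈ Δ)
    {h : Module.Dual ℤ N} (hh : ∀ x ∈ C, x ≠ 0 → 0 < pairing h x) (l : Module.Dual ℤ N) :
    ∃ B : ℕ, ∀ n ∈ latticePoints C, |l n| ≤ B * h n := by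
  refine ⟨(∑ d ∈ raysIn Δ C, |l d|).toNat, fun n hn => ?_⟩
  have hB0 : 0 ≤ ∑ d ∈ raysIn Δ C, |l d| := Finset.sum_nonneg fun _ _ => abs_nonneg _
  obtain ⟨t, ht, hnt⟩ := exists_eq_sum_rays hΔ hC hn
  have hpair : ∀ m : Module.Dual ℤ N, (m n : ℝ) = ∑ d ∈ raysIn Δ C, t d * m d := by
    intro m
    rw [← pairing_toReal, hnt]
    simp [pairing_toReal]
  suffices (|l n| : ℝ) ≤ (∑ d ∈ raysIn Δ C, (|l d| : ℝ)) * h n by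
    rw [Int.toNat_of_nonneg hB0]; exact_mod_cast this
  rw [hpair l, hpair h, Finset.mul_sum]
  refine (Finset.abs_sum_le_sum_abs _ _).trans (Finset.sum_le_sum fun d hd => ?_)
  rw [abs_mul, abs_of_nonneg (ht d), mul_left_comm]
  refine mul_le_mul_of_nonneg_left ?_ (ht d)
  have h1 : (1 : ℝ) ≤ h d := by
    have := hh _ (mem_raysIn.1 hd).2 fun h0 =>
      (mem_raysIn.1 hd).1.ne_zero (toReal_eq_zero h0)
    rw [pairing_toReal] at this
    exact_mod_cast this
  have h2 : (|l d| : ℝ) ≤ ∑ d ∈ raysIn Δ C, (|l d| : ℝ) :=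
    Finset.single_le_sum (f := fun d => (|l d| : ℝ)) (fun _ _ => abs_nonneg _) hd
  nlinarith [abs_nonneg (l d : ℝ)]

theorem finite_latticePoints_le [Module.Finite ℤ N] (hΔ : IsCompleteFan Δ)
    {C : Set (ℝ ⊗[ℤ] N)} (hC : C ∈ Δ) {h : Module.Dual ℤ N}
    (hh : ∀ x ∈ C, x ≠ 0 → 0 < pairing h x) (K : ℤ) :
    {n | n ∈ latticePoints C ∧ h n ≤ K}.Finite := by
  let b := Module.Free.chooseBasis ℤ N
  choose B hB using fun i => exists_abs_le_mul hΔ hC hh (b.coord i)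
  refine Set.Finite.of_finite_image (f := b.equivFun)
    ((Set.finite_Icc (fun i => -(B i * K)) (fun i => B i * K)).subset ?_)
    b.equivFun.injective.injOn
  rintro _ ⟨n, ⟨hn, hnK⟩, rfl⟩
  have : ∀ i, |b.equivFun n i| ≤ B i * K := fun i =>
    (hB i n hn).trans (mul_le_mul_of_nonneg_left hnK (by positivity))
  exact ⟨fun i => (abs_le.1 (this i)).1, fun i => (abs_le.1 (this i)).2⟩

/-- The generating series of the lattice points of a cone becomes a Laurent polynomial after
multiplication by `∏ (1 - x ^ d)` over the ray generators `d` of the cone. -/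
theorem finite_support_act_denom [Module.Finite ℤ N] (hΔ : IsCompleteFan Δ)
    {C : Set (ℝ ⊗[ℤ] N)} (hC : C ∈ Δ) :
    (Function.support (act (denom (raysIn Δ C) 1) ((latticePoints C).indicator 1))).Finite := by
  classical
  obtain ⟨⟨s, rfl⟩, -⟩ := hΔ.isCone C hC
  set D := raysIn Δ (polyCone s) with hD
  have hDC : ∀ d ∈ D, ∀ m ∈ s, 0 ≤ m d := fun d hd =>
    mem_latticePoints_polyCone.1 (mem_raysIn.1 hd).2
  have hIC : ∀ I ⊆ D, ∀ m ∈ s, 0 ≤ m (∑ i ∈ I, i) := fun I hI m hm => by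
    rw [map_sum]; exact Finset.sum_nonneg fun d hd => hDC d (hI hd) m hm
  set B : ℤ := ∑ m ∈ s, m (∑ d ∈ D, d) with hB
  have hle : ∀ I ⊆ D, ∀ m ∈ s, m (∑ i ∈ I, i) ≤ B := fun I hI m hm => calc
    m (∑ i ∈ I, i) ≤ m (∑ i ∈ D, i) := by
      rw [map_sum, map_sum]
      exact Finset.sum_le_sum_of_subset_of_nonneg hI fun d hd _ => hDC d hd m hm
    _ ≤ B := Finset.single_le_sum (f := fun m : Module.Dual ℤ N => m (∑ d ∈ D, d))
        (fun m hm => hIC D subset_rfl m hm) hm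
  -- the exponents that can occur are cut out by subsets `t` of the inequalities `s` that suffice
  -- to exclude all points of the cone but the origin
  have hsub : Function.support (act (denom D 1) ((latticePoints (polyCone s)).indicator 1)) ⊆
      ⋃ t ∈ s.powerset.filter fun t => ∀ x ∈ polyCone s, x ≠ 0 → 0 < pairing (∑ m ∈ t, m) x,
        {n | n ∈ latticePoints (polyCone s) ∧ (∑ m ∈ t, m) n ≤ t.card * B} := by
    intro n hn
    have hnC : n ∈ latticePoints (polyCone s) := by
      by_contra hnC
      refine hn (act_denom_eq_zero_of_forall_subset _ _ _ fun I hI => ?_)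
      refine Set.indicator_of_notMem (fun h => hnC ?_) _
      rw [mem_latticePoints_polyCone] at h ⊢
      intro m hm
      have h1 := h m hm
      have h2 := hIC I hI m hm
      rw [map_sub] at h1
      linarith
    set t : Finset (Module.Dual ℤ N) := {m ∈ s | m n < B} with ht
    have hts : t ⊆ s := Finset.filter_subset _ _
    simp only [Set.mem_iUnion]
    refine ⟨t, Finset.mem_filter.2 ⟨Finset.mem_powerset.2 hts, fun x hx hx0 => ?_⟩, hnC, ?_⟩
    · by_contra hneg
      apply hn
      have hzero : ∀ m ∈ t, pairing m x = 0 := by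
        rw [pairing_sum_left] at hneg
        have h0 : ∀ m ∈ t, 0 ≤ pairing m x := fun m hm => hx m (hts hm)
        exact (Finset.sum_eq_zero_iff_of_nonneg h0).1
          (le_antisymm (not_lt.1 hneg) (Finset.sum_nonneg h0))
      have hF := hΔ.face_mem _ hC {y | y ∈ polyCone s ∧ ∀ m ∈ t, pairing m y = 0}
        ⟨s, t, hts, rfl, rfl⟩
      obtain ⟨c, -, hxc⟩ := exists_eq_sum_rays hΔ hF (x := x) ⟨hx, hzero⟩
      obtain ⟨d, hd⟩ : (raysIn Δ {y | y ∈ polyCone s ∧ ∀ m ∈ t, pairing m y = 0}).Nonempty := by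
        by_contra hne
        rw [Finset.not_nonempty_iff_eq_empty] at hne
        rw [hne] at hxc
        exact hx0 (by simpa using hxc)
      obtain ⟨hdray, hdC, hdt⟩ := mem_raysIn.1 hd
      have hdD : d ∈ D := mem_raysIn.2 ⟨hdray, hdC⟩
      refine act_denom_eq_zero_of_shift D hdD _ _ fun I hI => ?_
      have hId : insert d I ⊆ D :=
        Finset.insert_subset hdD (hI.trans (Finset.erase_subset _ _))
      have hdI : d ∉ I := fun h => (Finset.mem_erase.1 (hI h)).1 rfl
      have hiff : n - ∑ i ∈ I, i ∈ latticePoints (polyCone s) ↔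
          n - ∑ i ∈ I, i - d ∈ latticePoints (polyCone s) := by
        rw [mem_latticePoints_polyCone, mem_latticePoints_polyCone]
        refine forall₂_congr fun m hm => ?_
        by_cases hmt : m ∈ t
        · have : m d = 0 := by
            have := hdt m hmt
            rw [pairing_toReal] at this
            exact_mod_cast this
          rw [map_sub m _ d, this, sub_zero]
        · have h1 : B ≤ m n := by
            by_contra h
            exact hmt (Finset.mem_filter.2 ⟨hm, not_le.1 h⟩)
          have h2 := hle _ hId m hm
          rw [Finset.sum_insert hdI, map_add] at h2
          have h3 := hDC d hdD m hm
          rw [map_sub m _ d, map_sub]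
          constructor <;> intro <;> linarith
      by_cases hmem : n - ∑ i ∈ I, i ∈ latticePoints (polyCone s)
      · rw [Set.indicator_of_mem hmem, Set.indicator_of_mem (hiff.1 hmem)]; rfl
      · rw [Set.indicator_of_notMem hmem, Set.indicator_of_notMem fun h => hmem (hiff.2 h)]
    · rw [LinearMap.sum_apply, ← nsmul_eq_mul]
      exact Finset.sum_le_card_nsmul _ _ _ fun m hm => (Finset.mem_filter.1 hm).2.le
  refine (Set.Finite.biUnion (Finset.finite_toSet _) fun t ht => ?_).subset hsub
  exact finite_latticePoints_le hΔ hC (Finset.mem_filter.1 ht).2 _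

/-- The series of the lattice points `n` with `n + w / L ∈ C` has the same denominator as that of
`C`, and the exponents of its numerator satisfy a bound that is strict in the directions `m` with
`m · w < 0`. -/
theorem exists_numerator_shift [Module.Finite ℤ N] (hΔ : IsCompleteFan Δ)
    {C : Set (ℝ ⊗[ℤ] N)} (hC : C ∈ Δ) {L : ℕ} (hL : L ≠ 0) (w : N) :
    ∃ P : AddMonoidAlgebra ℂ N,
      act (denom (raysIn Δ C) 1) (fun n => (latticePoints C).indicator 1 (L • n + w)) = P.coeff ∧
      ∀ (m : Module.Dual ℤ N) (n : N), P.coeff n ≠ 0 →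
        -m w ≤ L * (m n + negPart (raysIn Δ C) m) := by
  obtain ⟨P, hP⟩ := exists_coeff_eq (finite_support_act_denom hΔ hC)
  have hdil := act_denom_dilate _ _ P hP L w
  have hinj : Function.Injective fun n : N => L • n := fun a b hab =>
    smul_right_injective N (r := (L : ℤ)) (by exact_mod_cast hL) (by simpa using hab)
  obtain ⟨R, hR⟩ := exists_coeff_eq (N := N)
    (g := act (denom (raysIn Δ C) 1) fun n => (latticePoints C).indicator 1 (L • n + w)) (by
      refine Set.Finite.subset (Set.Finite.preimage (f := fun n : N => L • n)
        hinj.injOn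
        (geomFactor (raysIn Δ C) L *
          (AddMonoidAlgebra.single (-w) 1 * P)).coeff.hasFiniteSupport) ?_
      intro n hn
      rw [Function.mem_support, hdil] at hn
      exact hn)
  refine ⟨R, hR, fun m n hn => ?_⟩
  rw [← hR, hdil] at hn
  have h2 : ∀ n, (latticePoints C).indicator (1 : N → ℂ) (2 • n) =
      (latticePoints C).indicator 1 n := by
    obtain ⟨⟨s, rfl⟩, -⟩ := hΔ.isCone C hC
    intro n
    have : 2 • n ∈ latticePoints (polyCone s) ↔ n ∈ latticePoints (polyCone s) := by
      simp [mem_latticePoints_polyCone]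
    by_cases hmem : n ∈ latticePoints (polyCone s)
    · rw [Set.indicator_of_mem hmem, Set.indicator_of_mem (this.2 hmem)]; rfl
    · rw [Set.indicator_of_notMem hmem, Set.indicator_of_notMem fun h => hmem (this.1 h)]
  have := le_of_dilate_ne_zero _ P m
    (fun k hk => neg_negPart_le_of_two_nsmul _ _ h2 P hP m hk) w hn
  linarith

/-- Weighting a series supported in a cone by the factors `exp (2 π i deg n)`, which form a
character on the cone, introduces no new exponents in the numerator. -/
theorem exists_numerator_twist {deg : N → ℂ} (hdeg : IsDegreeFunction Δ deg)
    {C : Set (ℝ ⊗[ℤ] N)} (hC : C ∈ Δ) {g : N → ℂ} (hg : ∀ n, g n ≠ 0 → n ∈ latticePoints C)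
    {P : AddMonoidAlgebra ℂ N} (hP : act (denom (raysIn Δ C) 1) g = P.coeff) :
    ∃ R : AddMonoidAlgebra ℂ N,
      act (denom (raysIn Δ C) (expDeg deg)) (fun n => expDeg deg n * g n) = R.coeff ∧
      ∀ n, R.coeff n ≠ 0 → P.coeff n ≠ 0 := by
  obtain ⟨l, hl⟩ := hdeg C hC
  have hl' : ∀ n ∈ latticePoints C, expDeg deg n = expDeg l n := fun n hn => by
    rw [expDeg, expDeg, hl n hn]
  have h1 : denom (raysIn Δ C) (expDeg deg) = denom (raysIn Δ C) (expDeg l) :=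
    Finset.prod_congr rfl fun d hd => by rw [hl' d (mem_raysIn.1 hd).2]
  have h2 : (fun n => expDeg deg n * g n) = fun n => expDeg l n * g n := by
    funext n
    by_cases hn : g n = 0
    · rw [hn, mul_zero, mul_zero]
    · rw [hl' n (hg n hn)]
  have h3 : ∀ n, act (denom (raysIn Δ C) (expDeg deg)) (fun n => expDeg deg n * g n) n =
      expDeg l n * P.coeff n := fun n => by
    rw [h1, h2, act_denom_twist _ _ (expDeg_linear_add l), hP]
  obtain ⟨R, hR⟩ := exists_coeff_eq (N := N)
    (g := act (denom (raysIn Δ C) (expDeg deg)) (fun n => expDeg deg n * g n)) (by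
      refine P.coeff.hasFiniteSupport.subset fun n hn => ?_
      rw [Function.mem_support, h3] at hn
      exact right_ne_zero_of_mul hn)
  refine ⟨R, hR, fun n hn => ?_⟩
  rw [← hR, h3] at hn
  exact right_ne_zero_of_mul hn

/-- The rational function that represents the sums over the lattice points of a cone. -/
theorem exists_numerator_cone [Module.Finite ℤ N] (hΔ : IsCompleteFan Δ) {deg : N → ℂ}
    (hdeg : IsDegreeFunction Δ deg) {C : Set (ℝ ⊗[ℤ] N)} (hC : C ∈ Δ) :
    ∃ R : AddMonoidAlgebra ℂ N,
      act (denom (raysIn Δ C) (expDeg deg)) ((latticePoints C).indicator (expDeg deg)) =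
        R.coeff := by
  obtain ⟨P, hP⟩ := exists_coeff_eq (finite_support_act_denom hΔ hC)
  obtain ⟨R, hR, -⟩ := exists_numerator_twist hdeg hC
    (fun n hn => by by_contra h; exact hn (Set.indicator_of_notMem h _)) hP
  refine ⟨R, hR ▸ congrArg _ ?_⟩
  funext n
  by_cases h : n ∈ latticePoints C <;> simp [h]

/-- If the cones of the fan shifted by `-w / L` partition the lattice points, then the series of
all `exp (2 π i deg n) x ^ n` is a rational function whose numerator has exponents in the interior
of the Newton polytope of the denominator, as far as the direction of `w` is concerned. -/
theorem exists_numerator_total [Module.Finite ℤ N] (hΔ : IsCompleteFan Δ) {deg : N → ℂ}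
    (hdeg : IsDegreeFunction Δ deg) {L : ℕ} (hL : L ≠ 0) {w : N}
    (hpart : ∀ n, ∃! C, C ∈ Δ ∧ L • n + w ∈ latticePoints C)
    (hmem : ∀ n, ∀ C ∈ Δ, L • n + w ∈ latticePoints C → n ∈ latticePoints C) :
    ∃ P : AddMonoidAlgebra ℂ N, act (denom (rays Δ) (expDeg deg)) (expDeg deg) = P.coeff ∧
      ∀ (m : Module.Dual ℤ N) (n : N), P.coeff n ≠ 0 →
        -m w ≤ L * (m n + negPart (rays Δ) m) := by
  classical
  have hex : ∀ C : Δ, ∃ R : AddMonoidAlgebra ℂ N,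
      act (denom (raysIn Δ C.1) (expDeg deg))
        (fun n => expDeg deg n * (latticePoints C.1).indicator 1 (L • n + w)) = R.coeff ∧
      ∀ (m : Module.Dual ℤ N) (n : N), R.coeff n ≠ 0 →
        -m w ≤ L * (m n + negPart (raysIn Δ C.1) m) := by
    rintro ⟨C, hC⟩
    obtain ⟨P, hP, hPm⟩ := exists_numerator_shift hΔ hC hL w
    obtain ⟨R, hR, hRP⟩ := exists_numerator_twist hdeg hC
      (fun n hn => by
        by_contra h
        exact hn (Set.indicator_of_notMem (fun h' => h (hmem n C hC h')) _)) hP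
    exact ⟨R, hR, fun m n hn => hPm m n (hRP n hn)⟩
  choose R hR hRm using hex
  have hsum : expDeg deg = ∑ C : Δ,
      fun n => expDeg deg n * (latticePoints C.1).indicator 1 (L • n + w) := by
    funext n
    obtain ⟨C, ⟨hC, hCn⟩, huniq⟩ := hpart n
    rw [Finset.sum_apply, Finset.sum_eq_single_of_mem ⟨C, hC⟩ (Finset.mem_univ _)]
    · simp [hCn]
    · rintro ⟨C', hC'⟩ - hne
      have : L • n + w ∉ latticePoints C' := fun h => hne (Subtype.ext (huniq C' ⟨hC', h⟩))
      simp [this]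
  refine ⟨∑ C : Δ, denom (rays Δ \ raysIn Δ C.1) (expDeg deg) * R C, ?_, fun m n hn => ?_⟩
  · have hact := congrArg (act (denom (rays Δ) (expDeg deg))) hsum
    rw [map_sum] at hact
    rw [hact, AddMonoidAlgebra.coeff_sum, Finsupp.coe_finsetSum]
    refine Finset.sum_congr rfl fun C _ => ?_
    rw [← denom_mul_denom_sdiff (raysIn_subset C.1), act_mul, hR, act_coeff]
  · rw [AddMonoidAlgebra.coeff_sum, Finsupp.coe_finsetSum, Finset.sum_apply] at hn
    obtain ⟨C, -, hC⟩ := Finset.exists_ne_zero_of_sum_ne_zero hn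
    obtain ⟨a, b, ha, hb, rfl⟩ := exists_add_of_coeff_mul_ne_zero hC
    have h1 := neg_negPart_le_of_coeff_denom_ne_zero _ _ m ha
    have h2 := hRm C m b hb
    have h3 := negPart_sdiff_add (raysIn_subset (Δ := Δ) C.1) m
    rw [map_add]
    have hL0 : (0 : ℤ) ≤ L := by positivity
    nlinarith

end Numerators

/-! ### Generic shifts of the fan -/

section Generic

theorem add_mul_ne_zero_of_abs_lt {a b K : ℤ} (hK : |a| < K) (h : a ≠ 0 ∨ b ≠ 0) :
    a + K * b ≠ 0 := by
  intro h0
  have hb : b ≠ 0 := by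
    rintro rfl
    rw [mul_zero, add_zero] at h0
    simp [h0] at h
  have h1 : |a| = K * |b| := by
    rw [eq_neg_of_add_eq_zero_left h0, abs_neg, abs_mul, abs_of_pos ((abs_nonneg a).trans_lt hK)]
  have h2 := Int.one_le_abs hb
  nlinarith [abs_nonneg a]

/-- Finitely many nonzero functionals are simultaneously nonzero at some lattice point. -/
theorem exists_forall_ne_zero {N : Type*} [AddCommGroup N] (T : Finset (Module.Dual ℤ N)) :
    ∃ g : N, ∀ m ∈ T, m ≠ 0 → m g ≠ 0 := by
  classical
  induction T using Finset.induction_on with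
  | empty => exact ⟨0, by simp⟩
  | insert m T hm ih =>
    obtain ⟨g, hg⟩ := ih
    by_cases hm0 : m = 0
    · refine ⟨g, fun m' hm' h0 => ?_⟩
      rcases Finset.mem_insert.1 hm' with rfl | h
      · exact absurd hm0 h0
      · exact hg m' h h0
    obtain ⟨v, hv⟩ : ∃ v, m v ≠ 0 := by
      by_contra! h
      exact hm0 (LinearMap.ext h)
    refine ⟨v + (1 + ∑ m' ∈ insert m T, |m' v|) • g, fun m' hm' h0 => ?_⟩
    rw [map_add, map_smul, smul_eq_mul]
    refine add_mul_ne_zero_of_abs_lt ?_ ?_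
    · have := Finset.single_le_sum (f := fun m' : Module.Dual ℤ N => |m' v|)
        (fun _ _ => abs_nonneg _) hm'
      linarith
    · rcases Finset.mem_insert.1 hm' with rfl | h
      · exact Or.inl hv
      · exact Or.inr (hg m' h h0)

variable {N : Type*} [AddCommGroup N] {Δ : Finset (Set (ℝ ⊗[ℤ] N))}

/-- For `w` outside finitely many hyperplanes, each of the points `n + w / L` with `n` in the
lattice and `L` large lies in exactly one cone of a complete fan, and this cone contains `n`. -/
theorem exists_generic_shift (hΔ : IsCompleteFan Δ) :
    ∃ T : Finset (Module.Dual ℤ N), ∀ (w : N) (L : ℕ), (∀ m ∈ T, m ≠ 0 → m w ≠ 0) →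
      (∀ m ∈ T, |m w| < L) →
      (∀ n, ∃! C, C ∈ Δ ∧ L • n + w ∈ latticePoints C) ∧
      ∀ n, ∀ C ∈ Δ, L • n + w ∈ latticePoints C → n ∈ latticePoints C := by
  classical
  choose s hs using fun C : Δ => (hΔ.isCone C.1 C.2).1
  have hface : ∀ p : Δ × Δ, ∃ t : Finset (Module.Dual ℤ N),
      p.1.1 ∩ p.2.1 = {x | x ∈ p.1.1 ∧ ∀ m ∈ t, pairing m x = 0} := fun p => by
    obtain ⟨-, t, -, -, h⟩ := (hΔ.inter_isFace _ p.1.2 _ p.2.2).1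
    exact ⟨t, h⟩
  choose t ht using hface
  refine ⟨Finset.univ.biUnion s ∪ Finset.univ.biUnion t, fun w L hw hL => ⟨fun n => ?_, ?_⟩⟩
  · have hsub : ∀ C C' : Δ, toReal (L • n + w) ∈ C.1 → toReal (L • n + w) ∈ C'.1 →
        C.1 ⊆ C'.1 := by
      intro C C' h h'
      have hmem : toReal (L • n + w) ∈ C.1 ∩ C'.1 := ⟨h, h'⟩
      have hzero : ∀ m ∈ t (C, C'), m = 0 := by
        intro m hm
        by_contra hm0
        have hmT : m ∈ Finset.univ.biUnion s ∪ Finset.univ.biUnion t :=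
          Finset.mem_union_right _ (Finset.mem_biUnion.2 ⟨_, Finset.mem_univ _, hm⟩)
        rw [ht (C, C')] at hmem
        have h0 := hmem.2 m hm
        rw [pairing_toReal, map_add, map_nsmul, nsmul_eq_mul, add_comm] at h0
        exact add_mul_ne_zero_of_abs_lt (hL m hmT) (Or.inl (hw m hmT hm0)) (by exact_mod_cast h0)
      have : C.1 ∩ C'.1 = C.1 := by
        rw [ht (C, C')]
        ext x
        refine ⟨fun h => h.1, fun h => ⟨h, fun m hm => ?_⟩⟩
        rw [hzero m hm, pairing_zero_left]
      exact Set.inter_eq_left.1 this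
    obtain ⟨C, hC, hCn⟩ := hΔ.complete (toReal (L • n + w))
    exact ⟨C, ⟨hC, hCn⟩, fun C' h => Set.Subset.antisymm
      (hsub ⟨C', h.1⟩ ⟨C, hC⟩ h.2 hCn) (hsub ⟨C, hC⟩ ⟨C', h.1⟩ hCn h.2)⟩
  · intro n C hC hCn
    have hsC : C = polyCone (s ⟨C, hC⟩) := hs ⟨C, hC⟩
    rw [hsC, mem_latticePoints_polyCone] at hCn ⊢
    intro m hm
    have h1 := hL m (Finset.mem_union_left _ (Finset.mem_biUnion.2 ⟨_, Finset.mem_univ _, hm⟩))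
    have h2 := hCn m hm
    rw [map_add, map_nsmul, nsmul_eq_mul] at h2
    by_contra hneg
    have h3 := (abs_lt.1 h1).2
    nlinarith [abs_nonneg (m w)]

/-- The series of all `exp (2 π i deg n) x ^ n` is a rational function; its numerator lies in the
interior of the Newton polytope of the denominator, so that in the direction `m` the exponents of
the quotient grow at least linearly with the size of `m`. -/
theorem exists_numerator_growth [Module.Free ℤ N] [Module.Finite ℤ N] (hΔ : IsCompleteFan Δ)
    {deg : N → ℂ} (hdeg : IsDegreeFunction Δ deg) {ι : Type*} [Fintype ι]
    (b : Module.Basis ι ℤ N) :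
    ∃ (P : AddMonoidAlgebra ℂ N) (L : ℕ), L ≠ 0 ∧
      act (denom (rays Δ) (expDeg deg)) (expDeg deg) = P.coeff ∧
      ∀ (m : Module.Dual ℤ N) (n : N), P.coeff n ≠ 0 →
        ∑ i, |m (b i)| ≤ L * (m n + negPart (rays Δ) m) := by
  classical
  obtain ⟨T, hT⟩ := exists_generic_shift hΔ
  obtain ⟨g, hg⟩ := exists_forall_ne_zero T
  -- for the direction `m`, shift by `w σ` with `σ` the signs of the coordinates of `m`
  set v : (ι → SignType) → N := fun σ => -∑ i, (σ i : ℤ) • b i with hv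
  set K : ℤ := 1 + ∑ i, |b.repr g i| + ∑ m ∈ T, |m g| with hK
  set w : (ι → SignType) → N := fun σ => g + K • v σ with hw
  have hT0 : 0 ≤ ∑ m ∈ T, |m g| := Finset.sum_nonneg fun _ _ => abs_nonneg _
  have hι0 : 0 ≤ ∑ i, |b.repr g i| := Finset.sum_nonneg fun _ _ => abs_nonneg _
  have hwT : ∀ σ, ∀ m ∈ T, m ≠ 0 → m (w σ) ≠ 0 := by
    intro σ m hm hm0
    rw [hw, map_add, map_smul, smul_eq_mul]
    refine add_mul_ne_zero_of_abs_lt ?_ (Or.inl (hg m hm hm0))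
    have := Finset.single_le_sum (f := fun m : Module.Dual ℤ N => |m g|)
      (fun _ _ => abs_nonneg _) hm
    linarith
  set L : ℕ := (1 + ∑ σ, ∑ m ∈ T, |m (w σ)|).toNat with hL
  have hLZ : (L : ℤ) = 1 + ∑ σ, ∑ m ∈ T, |m (w σ)| := Int.toNat_of_nonneg (by positivity)
  have hL0 : L ≠ 0 := by
    have : 0 ≤ ∑ σ, ∑ m ∈ T, |m (w σ)| := by positivity
    omega
  have hwL : ∀ σ, ∀ m ∈ T, |m (w σ)| < L := by
    intro σ m hm
    have h1 := Finset.single_le_sum (f := fun m : Module.Dual ℤ N => |m (w σ)|)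
      (fun _ _ => abs_nonneg _) hm
    have h2 := Finset.single_le_sum (f := fun σ => ∑ m ∈ T, |m (w σ)|)
      (fun _ _ => Finset.sum_nonneg fun _ _ => abs_nonneg _) (Finset.mem_univ σ)
    linarith
  have hP : ∀ σ, ∃ P : AddMonoidAlgebra ℂ N,
      act (denom (rays Δ) (expDeg deg)) (expDeg deg) = P.coeff ∧
      ∀ (m : Module.Dual ℤ N) (n : N), P.coeff n ≠ 0 →
        -m (w σ) ≤ L * (m n + negPart (rays Δ) m) := fun σ =>
    exists_numerator_total hΔ hdeg hL0 (hT (w σ) L (hwT σ) (hwL σ)).1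
      (hT (w σ) L (hwT σ) (hwL σ)).2
  obtain ⟨P, hP0, -⟩ := hP 0
  refine ⟨P, L, hL0, hP0, fun m n hn => ?_⟩
  obtain ⟨P', hP', hbound⟩ := hP fun i => SignType.sign (m (b i))
  have hPP' : P'.coeff = P.coeff := DFunLike.coe_injective (hP'.symm.trans hP0)
  refine le_trans ?_ (hbound m n (by rwa [hPP']))
  have hmv : m (v fun i => SignType.sign (m (b i))) = -∑ i, |m (b i)| := by
    rw [hv, map_neg, map_sum]
    congr 1
    refine Finset.sum_congr rfl fun i _ => ?_
    rw [map_smul, smul_eq_mul, sign_mul_self]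
  have hmg : m g ≤ (∑ i, |b.repr g i|) * ∑ i, |m (b i)| := by
    conv_lhs => rw [← b.sum_repr g]
    rw [map_sum, Finset.sum_mul]
    refine Finset.sum_le_sum fun i _ => ?_
    rw [map_smul, smul_eq_mul]
    refine (le_abs_self _).trans ?_
    rw [abs_mul]
    refine mul_le_mul_of_nonneg_left ?_ (abs_nonneg _)
    exact Finset.single_le_sum (f := fun i => |m (b i)|) (fun _ _ => abs_nonneg _)
      (Finset.mem_univ i)
  have hm0 : 0 ≤ ∑ i, |m (b i)| := Finset.sum_nonneg fun _ _ => abs_nonneg _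
  rw [hw, map_add, map_smul, smul_eq_mul, hmv, hK]
  nlinarith

end Generic

/-! ### Euler's relation for complete fans -/

section Cells

variable {V : Type*} [AddCommGroup V] [Module ℝ V]

/-- The relatively open cone cut out by homogeneous equations and strict inequalities. -/
def openCell (Z P : Finset (Module.Dual ℝ V)) : Set V :=
  {y | (∀ l ∈ Z, l y = 0) ∧ ∀ l ∈ P, 0 < l y}

/-- The common zeros of finitely many functionals. -/
def zeroSpace (Z : Finset (Module.Dual ℝ V)) : Submodule ℝ V :=
  ⨅ l ∈ Z, LinearMap.ker l

theorem mem_zeroSpace {Z : Finset (Module.Dual ℝ V)} {y : V} :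
    y ∈ zeroSpace Z ↔ ∀ l ∈ Z, l y = 0 := by
  simp [zeroSpace]

open Classical in
/-- The Euler characteristic with compact support of a relatively open cell `U`: the sign
`(-1) ^ dim U`, or `0` for the empty set. -/
def cellSign (U : Set V) : ℤ :=
  if U.Nonempty then (-1) ^ Module.finrank ℝ (Submodule.span ℝ U) else 0

theorem cellSign_empty : cellSign (∅ : Set V) = 0 := by simp [cellSign]

theorem exists_pos_forall_abs_lt (P : Finset (Module.Dual ℝ V)) {y : V} (hy : ∀ l ∈ P, 0 < l y)
    (w : V) : ∃ ε : ℝ, 0 < ε ∧ ∀ δ : ℝ, |δ| < ε → ∀ l ∈ P, 0 < l (y + δ • w) := by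
  have : ∀ᶠ δ : ℝ in nhds 0, ∀ l ∈ P, 0 < l (y + δ • w) := by
    rw [Filter.eventually_all_finset]
    intro l hl
    have hc : Continuous fun δ : ℝ => l (y + δ • w) := by
      simp only [map_add, map_smul, smul_eq_mul]
      fun_prop
    exact hc.continuousAt.eventually (lt_mem_nhds (by simpa using hy l hl))
  obtain ⟨ε, hε, h⟩ := Metric.eventually_nhds_iff.1 this
  exact ⟨ε, hε, fun δ hδ => h (by simpa using hδ)⟩

theorem exists_pos_add_smul_mem {Z P : Finset (Module.Dual ℝ V)} {y w : V} (hy : y ∈ openCell Z P)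
    (hw : w ∈ zeroSpace Z) :
    ∃ ε : ℝ, 0 < ε ∧ y + ε • w ∈ openCell Z P ∧ y - ε • w ∈ openCell Z P := by
  obtain ⟨ε, hε, h⟩ := exists_pos_forall_abs_lt P hy.2 w
  rw [mem_zeroSpace] at hw
  refine ⟨ε / 2, by positivity, ⟨fun l hl => ?_, h _ ?_⟩, fun l hl => ?_, ?_⟩
  · simp [hy.1 l hl, hw l hl]
  · rw [abs_of_pos (by positivity)]; linarith
  · simp [hy.1 l hl, hw l hl]
  · have := h (-(ε / 2)) (by rw [abs_neg, abs_of_pos (by positivity)]; linarith)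
    simpa [sub_eq_add_neg] using this

theorem span_openCell {Z P : Finset (Module.Dual ℝ V)} (h : (openCell Z P).Nonempty) :
    Submodule.span ℝ (openCell Z P) = zeroSpace Z := by
  refine le_antisymm (Submodule.span_le.2 fun y hy => mem_zeroSpace.2 hy.1) fun w hw => ?_
  obtain ⟨y, hy⟩ := h
  obtain ⟨ε, hε, hyw, -⟩ := exists_pos_add_smul_mem hy hw
  have : w = ε⁻¹ • ((y + ε • w) - y) := by
    rw [add_sub_cancel_left, smul_smul, inv_mul_cancel₀ hε.ne', one_smul]
  rw [this]
  exact Submodule.smul_mem _ _ (Submodule.sub_mem _ (Submodule.subset_span hyw)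
    (Submodule.subset_span hy))

theorem cellSign_openCell {Z P : Finset (Module.Dual ℝ V)} (h : (openCell Z P).Nonempty) :
    cellSign (openCell Z P) = (-1) ^ Module.finrank ℝ (zeroSpace Z) := by
  rw [cellSign, if_pos h, span_openCell h]

theorem finrank_inf_ker_add_one [FiniteDimensional ℝ V] (W : Submodule ℝ V)
    (l : Module.Dual ℝ V) {w : V} (hw : w ∈ W) (hl : l w ≠ 0) :
    Module.finrank ℝ (W ⊓ LinearMap.ker l : Submodule ℝ V) + 1 = Module.finrank ℝ W := by
  have h := Module.Dual.finrank_ker_add_one_of_ne_zero (f := l.domRestrict W) fun h =>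
    hl (by simpa using LinearMap.congr_fun h ⟨w, hw⟩)
  rw [← h, ← Submodule.map_comap_subtype, Submodule.finrank_map_subtype_eq]
  rfl

variable [DecidableEq (Module.Dual ℝ V)]

theorem openCell_inter (Z P Z' P' : Finset (Module.Dual ℝ V)) :
    openCell Z P ∩ openCell Z' P' = openCell (Z ∪ Z') (P ∪ P') := by
  ext y
  simp only [openCell, Set.mem_inter_iff, Set.mem_ofPred_eq, Finset.mem_union]
  grind

theorem openCell_inter_zero (Z P : Finset (Module.Dual ℝ V)) (l : Module.Dual ℝ V) :
    openCell Z P ∩ {y | l y = 0} = openCell (insert l Z) P := by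
  ext y
  simp [openCell]
  grind

theorem openCell_inter_pos (Z P : Finset (Module.Dual ℝ V)) (l : Module.Dual ℝ V) :
    openCell Z P ∩ {y | 0 < l y} = openCell Z (insert l P) := by
  ext y
  simp [openCell]
  grind

theorem openCell_inter_neg (Z P : Finset (Module.Dual ℝ V)) (l : Module.Dual ℝ V) :
    openCell Z P ∩ {y | l y < 0} = openCell Z (insert (-l) P) := by
  ext y
  simp [openCell]
  grind

/-- Cutting a cell by a hyperplane does not change the sum of the signs: a cell of dimension `k`
that is properly cut falls into two cells of dimension `k` and one of dimension `k - 1`. -/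
theorem cellSign_cut [FiniteDimensional ℝ V] (Z P : Finset (Module.Dual ℝ V))
    (l : Module.Dual ℝ V) :
    cellSign (openCell Z P ∩ {y | l y = 0}) + cellSign (openCell Z P ∩ {y | 0 < l y}) +
      cellSign (openCell Z P ∩ {y | l y < 0}) = cellSign (openCell Z P) := by
  rcases (openCell Z P).eq_empty_or_nonempty with hU | ⟨y₀, hy₀⟩
  · simp [hU, cellSign_empty]
  by_cases hW : ∀ w ∈ zeroSpace Z, l w = 0
  · have hl : ∀ y ∈ openCell Z P, l y = 0 := fun y hy => hW y (mem_zeroSpace.2 hy.1)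
    have h1 : openCell Z P ∩ {y | l y = 0} = openCell Z P := Set.inter_eq_left.2 hl
    have h2 : openCell Z P ∩ {y | 0 < l y} = ∅ :=
      Set.eq_empty_of_forall_notMem fun y hy => hy.2.ne' (hl y hy.1)
    have h3 : openCell Z P ∩ {y | l y < 0} = ∅ :=
      Set.eq_empty_of_forall_notMem fun y hy => (hy.2 : l y < 0).ne (hl y hy.1)
    rw [h1, h2, h3, cellSign_empty, add_zero, add_zero]
  push Not at hW
  obtain ⟨w, hw, hlw⟩ : ∃ w ∈ zeroSpace Z, 0 < l w := by
    obtain ⟨w, hw, hlw⟩ := hW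
    rcases lt_or_gt_of_ne hlw with h | h
    · exact ⟨-w, Submodule.neg_mem _ hw, by rw [map_neg]; linarith⟩
    · exact ⟨w, hw, h⟩
  by_cases h0 : ∃ y ∈ openCell Z P, l y = 0
  · obtain ⟨y, hy, hly⟩ := h0
    obtain ⟨ε, hε, hp, hn⟩ := exists_pos_add_smul_mem hy hw
    have e0 : (openCell Z P ∩ {y | l y = 0}).Nonempty := ⟨y, hy, hly⟩
    have e1 : (openCell Z P ∩ {y | 0 < l y}).Nonempty :=
      ⟨_, hp, by simp only [Set.mem_ofPred_eq, map_add, map_smul, hly, smul_eq_mul]; positivity⟩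
    have e2 : (openCell Z P ∩ {y | l y < 0}).Nonempty :=
      ⟨_, hn, by
        simp only [Set.mem_ofPred_eq, map_sub, map_smul, hly, smul_eq_mul]
        linarith [mul_pos hε hlw]⟩
    rw [openCell_inter_zero] at e0 ⊢
    rw [openCell_inter_pos] at e1 ⊢
    rw [openCell_inter_neg] at e2 ⊢
    rw [cellSign_openCell e0, cellSign_openCell e1, cellSign_openCell e2,
      cellSign_openCell ⟨y, hy⟩]
    have hz : zeroSpace (insert l Z) = zeroSpace Z ⊓ LinearMap.ker l := by
      ext y
      simp [mem_zeroSpace, and_comm]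
    rw [hz, ← finrank_inf_ker_add_one (zeroSpace Z) l hw hlw.ne', pow_succ]
    ring
  · push Not at h0
    have e0 : openCell Z P ∩ {y | l y = 0} = ∅ :=
      Set.eq_empty_of_forall_notMem fun y hy => h0 y hy.1 hy.2
    -- by convexity, `l` has constant sign on the cell
    have hconv : ∀ y ∈ openCell Z P, ∀ y' ∈ openCell Z P, 0 < l y → l y' < 0 → False := by
      intro y hy y' hy' h h'
      refine h0 (l y • y' + (-l y') • y) ⟨fun l' hl' => ?_, fun l' hl' => ?_⟩ ?_
      · simp [hy.1 l' hl', hy'.1 l' hl']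
      · have h1 := hy.2 l' hl'
        have h2 := hy'.2 l' hl'
        rw [map_add, map_smul, map_smul, smul_eq_mul, smul_eq_mul]
        have := mul_pos h h2
        have := mul_pos (neg_pos.2 h') h1
        linarith
      · simp only [map_add, map_smul, smul_eq_mul]; ring
    rcases lt_or_gt_of_ne (h0 y₀ hy₀) with h | h
    · have e1 : openCell Z P ∩ {y | 0 < l y} = ∅ :=
        Set.eq_empty_of_forall_notMem fun y hy => hconv y hy.1 y₀ hy₀ hy.2 h
      have e2 : openCell Z P ∩ {y | l y < 0} = openCell Z P :=
        Set.inter_eq_left.2 fun y hy => lt_of_le_of_ne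
          (not_lt.1 fun h' => hconv y hy y₀ hy₀ h' h) (h0 y hy)
      rw [e0, e1, e2, cellSign_empty, zero_add, zero_add]
    · have e1 : openCell Z P ∩ {y | l y < 0} = ∅ :=
        Set.eq_empty_of_forall_notMem fun y hy => hconv y₀ hy₀ y hy.1 h hy.2
      have e2 : openCell Z P ∩ {y | 0 < l y} = openCell Z P :=
        Set.inter_eq_left.2 fun y hy => lt_of_le_of_ne
          (not_lt.1 fun h' => hconv y₀ hy₀ y hy h h') (h0 y hy).symm
      rw [e0, e1, e2, cellSign_empty, zero_add, add_zero]

/-- The sum of the signs is invariant under partitions into cells: refine the partition by all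
hyperplanes that occur in it. Here `H` holds the hyperplanes by which `openCell Z₀ P₀` is still to
be cut. -/
theorem sum_cellSign_inter [FiniteDimensional ℝ V] {I : Type*} [Fintype I]
    (Z P : I → Finset (Module.Dual ℝ V)) (hpart : ∀ y, ∃! i, y ∈ openCell (Z i) (P i))
    (H : Finset (Module.Dual ℝ V)) (Z₀ P₀ : Finset (Module.Dual ℝ V))
    (hH : ∀ i, ∀ l ∈ Z i ∪ P i, l ∈ H ∨ (∀ y ∈ openCell Z₀ P₀, l y = 0) ∨
      (∀ y ∈ openCell Z₀ P₀, 0 < l y) ∨ ∀ y ∈ openCell Z₀ P₀, l y < 0) :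
    ∑ i, cellSign (openCell Z₀ P₀ ∩ openCell (Z i) (P i)) = cellSign (openCell Z₀ P₀) := by
  classical
  induction H using Finset.induction_on generalizing Z₀ P₀ with
  | empty =>
    rcases (openCell Z₀ P₀).eq_empty_or_nonempty with hU | ⟨y₀, hy₀⟩
    · simp [hU, cellSign_empty]
    obtain ⟨i, hi, -⟩ := hpart y₀
    have hsub : openCell Z₀ P₀ ⊆ openCell (Z i) (P i) := by
      intro y hy
      refine ⟨fun l hl => ?_, fun l hl => ?_⟩
      · have h0 := hi.1 l hl
        rcases hH i l (Finset.mem_union_left _ hl) with h | h | h | h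
        · simp at h
        · exact h y hy
        · exact absurd h0 (h y₀ hy₀).ne'
        · exact absurd h0 (h y₀ hy₀).ne
      · have h0 := hi.2 l hl
        rcases hH i l (Finset.mem_union_right _ hl) with h | h | h | h
        · simp at h
        · exact absurd (h y₀ hy₀) h0.ne'
        · exact h y hy
        · exact absurd h0 (h y₀ hy₀).not_gt
    rw [Finset.sum_eq_single_of_mem i (Finset.mem_univ i), Set.inter_eq_left.2 hsub]
    intro j _ hji
    have : openCell Z₀ P₀ ∩ openCell (Z j) (P j) = ∅ :=
      Set.eq_empty_of_forall_notMem fun y hy => hji ((hpart y).unique hy.2 (hsub hy.1))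
    rw [this, cellSign_empty]
  | insert l H _ ih =>
    have hcut : ∀ A : Set V, (∀ y ∈ A, l y = 0) ∨ (∀ y ∈ A, 0 < l y) ∨ (∀ y ∈ A, l y < 0) →
        A ⊆ openCell Z₀ P₀ → ∀ i, ∀ l' ∈ Z i ∪ P i, l' ∈ H ∨ (∀ y ∈ A, l' y = 0) ∨
          (∀ y ∈ A, 0 < l' y) ∨ ∀ y ∈ A, l' y < 0 := by
      intro A hA hsub i l' hl'
      rcases hH i l' hl' with h | h | h | h
      · rcases Finset.mem_insert.1 h with rfl | h
        · exact Or.inr hA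
        · exact Or.inl h
      · exact Or.inr (Or.inl fun y hy => h y (hsub hy))
      · exact Or.inr (Or.inr (Or.inl fun y hy => h y (hsub hy)))
      · exact Or.inr (Or.inr (Or.inr fun y hy => h y (hsub hy)))
    have h0 := ih (insert l Z₀) P₀ (by
      rw [← openCell_inter_zero]
      exact hcut _ (Or.inl fun y hy => hy.2) Set.inter_subset_left)
    have h1 := ih Z₀ (insert l P₀) (by
      rw [← openCell_inter_pos]
      exact hcut _ (Or.inr (Or.inl fun y hy => hy.2)) Set.inter_subset_left)
    have h2 := ih Z₀ (insert (-l) P₀) (by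
      rw [← openCell_inter_neg]
      exact hcut _ (Or.inr (Or.inr fun y hy => hy.2)) Set.inter_subset_left)
    rw [← cellSign_cut Z₀ P₀ l, openCell_inter_zero, openCell_inter_pos, openCell_inter_neg,
      ← h0, ← h1, ← h2, ← Finset.sum_add_distrib, ← Finset.sum_add_distrib]
    refine Finset.sum_congr rfl fun i _ => ?_
    rw [← openCell_inter_zero, ← openCell_inter_pos, ← openCell_inter_neg,
      Set.inter_right_comm, Set.inter_right_comm _ {y | 0 < l y},
      Set.inter_right_comm _ {y | l y < 0}, openCell_inter, cellSign_cut]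

end Cells

section Fans

variable {N : Type*} [AddCommGroup N]

/-- A point in the relative interior of a cone. -/
theorem exists_mem_relint (s : Finset (Module.Dual ℤ N)) :
    ∃ z ∈ polyCone s, ∀ m ∈ s, (∀ p ∈ polyCone s, pairing m p = 0) ∨ 0 < pairing m z := by
  classical
  have hex : ∀ m : Module.Dual ℤ N, ∃ p ∈ polyCone s,
      m ∈ s → (∀ p ∈ polyCone s, pairing m p = 0) ∨ 0 < pairing m p := by
    intro m
    by_cases h : ∃ p ∈ polyCone s, 0 < pairing m p
    · obtain ⟨p, hp, hmp⟩ := h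
      exact ⟨p, hp, fun _ => Or.inr hmp⟩
    · push Not at h
      exact ⟨0, fun m _ => by simp, fun hm => Or.inl fun p hp => le_antisymm (h p hp) (hp m hm)⟩
  choose p hp hpm using hex
  refine ⟨∑ m ∈ s, p m, fun m hm => ?_, fun m hm => ?_⟩
  · rw [map_sum]
    exact Finset.sum_nonneg fun m' _ => hp m' m hm
  · rcases hpm m hm with h | h
    · exact Or.inl h
    · right
      rw [map_sum]
      exact Finset.sum_pos' (fun m' _ => hp m' m hm) ⟨m, hm, h⟩

/-- A functional that is nonnegative on a cone and zero at a point of the relative interior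
vanishes on the cone. -/
theorem pairing_eq_zero_of_relint {s : Finset (Module.Dual ℤ N)} {z : ℝ ⊗[ℤ] N}
    (hz : ∀ m ∈ s, (∀ p ∈ polyCone s, pairing m p = 0) ∨ 0 < pairing m z)
    {m : Module.Dual ℤ N} (hm : ∀ p ∈ polyCone s, 0 ≤ pairing m p) (hmz : pairing m z = 0)
    {p : ℝ ⊗[ℤ] N} (hp : p ∈ polyCone s) (hzC : z ∈ polyCone s) : pairing m p = 0 := by
  classical
  obtain ⟨ε, hε, h⟩ := exists_pos_forall_abs_lt ((s.filter fun m => 0 < pairing m z).image pairing)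
    (y := z) (by
      intro l hl
      obtain ⟨m, hm, rfl⟩ := Finset.mem_image.1 hl
      exact (Finset.mem_filter.1 hm).2) (-p)
  have hmem : z + (ε / 2) • -p ∈ polyCone s := by
    intro m' hm'
    rcases hz m' hm' with h0 | h0
    · rw [map_add, map_smul, map_neg, h0 p hp, h0 z hzC]; simp
    · exact (h (ε / 2) (by rw [abs_of_pos (by positivity)]; linarith) _
        (Finset.mem_image_of_mem _ (Finset.mem_filter.2 ⟨hm', h0⟩))).le
  have h1 := hm _ hmem
  rw [map_add, map_smul, map_neg, hmz, smul_eq_mul] at h1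
  have h2 := hm p hp
  nlinarith

open Classical in
/-- Euler's relation, in the link of the point `x` of a complete fan. -/
theorem sum_neg_one_pow_coneCodim [Module.Free ℤ N] [Module.Finite ℤ N]
    {Δ : Finset (Set (ℝ ⊗[ℤ] N))} (hΔ : IsCompleteFan Δ) (x : ℝ ⊗[ℤ] N) :
    ∑ C ∈ Δ with x ∈ C, (-1 : ℤ) ^ coneCodim C = 1 := by
  choose! s hs using fun C (hC : C ∈ Δ) => (hΔ.isCone C hC).1
  have hΔx : ∀ C : Δ.filter (x ∈ ·), C.1 ∈ Δ ∧ x ∈ C.1 := fun C => Finset.mem_filter.1 C.2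
  let Z : Δ.filter (x ∈ ·) → Finset (Module.Dual ℝ (ℝ ⊗[ℤ] N)) := fun C =>
    ((s C.1).filter fun m => ∀ p ∈ C.1, pairing m p = 0).image pairing
  -- the cell of `C` holds the directions that lead from `x` into the relative interior of `C`
  let P : Δ.filter (x ∈ ·) → Finset (Module.Dual ℝ (ℝ ⊗[ℤ] N)) := fun C =>
    ((s C.1).filter fun m => pairing m x = 0 ∧ ¬ ∀ p ∈ C.1, pairing m p = 0).image pairing
  have hmem : ∀ C y, y ∈ openCell (Z C) (P C) ↔ ∀ m ∈ s C.1,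
      ((∀ p ∈ C.1, pairing m p = 0) → pairing m y = 0) ∧
      (pairing m x = 0 → ¬ (∀ p ∈ C.1, pairing m p = 0) → 0 < pairing m y) := by
    intro C y
    simp only [openCell, Z, P, Set.mem_ofPred_eq, Finset.forall_mem_image, Finset.mem_filter]
    grind
  have hdim : ∀ C, cellSign (openCell (Z C) (P C)) = (-1) ^ coneDim C.1 := by
    intro C
    obtain ⟨z, hz, hzs⟩ := exists_mem_relint (s C.1)
    rw [← hs C.1 (hΔx C).1] at hz hzs
    have hzU : z ∈ openCell (Z C) (P C) := (hmem C z).2 fun m hm =>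
      ⟨fun h => h z hz, fun _ h => (hzs m hm).resolve_left h⟩
    rw [cellSign_openCell ⟨z, hzU⟩, coneDim]
    refine congrArg (fun k => (-1 : ℤ) ^ k) ?_
    refine congrArg (fun W : Submodule ℝ (ℝ ⊗[ℤ] N) => Module.finrank ℝ W)
      (le_antisymm ?_ (Submodule.span_le.2 fun p hp => ?_))
    · let P' := ((s C.1).filter fun m => ¬ ∀ p ∈ C.1, pairing m p = 0).image pairing
      have hz' : z ∈ openCell (Z C) P' := by
        refine ⟨hzU.1, ?_⟩
        simp only [P', Finset.forall_mem_image, Finset.mem_filter]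
        exact fun m hm => (hzs m hm.1).resolve_left hm.2
      rw [← span_openCell ⟨z, hz'⟩]
      refine Submodule.span_mono fun y hy => ?_
      rw [hs C.1 (hΔx C).1]
      intro m hm
      by_cases h : ∀ p ∈ C.1, pairing m p = 0
      · exact (hy.1 _ (Finset.mem_image_of_mem _ (Finset.mem_filter.2 ⟨hm, h⟩))).ge
      · exact (hy.2 _ (Finset.mem_image_of_mem _ (Finset.mem_filter.2 ⟨hm, h⟩))).le
    · rw [SetLike.mem_coe, mem_zeroSpace]
      simp only [Z, Finset.forall_mem_image, Finset.mem_filter]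
      exact fun m hm => hm.2 p hp
  have hpart : ∀ y, ∃! C, y ∈ openCell (Z C) (P C) := by
    intro y
    let T : Finset (Module.Dual ℤ N) := Δ.biUnion s
    obtain ⟨ε, hε, hεT⟩ := exists_pos_forall_abs_lt
      ((T.filter fun m => 0 < pairing m x).image pairing ∪
        (T.filter fun m => pairing m x < 0).image fun m => -pairing m) (y := x) (by
          simp only [Finset.forall_mem_union, Finset.forall_mem_image, Finset.mem_filter]
          exact ⟨fun m hm => hm.2, fun m hm => neg_pos.2 hm.2⟩) y
    have hε2 : 0 < ε / 2 := by positivity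
    set z := x + (ε / 2) • y with hz
    have hzT := hεT (ε / 2) (by rw [abs_of_pos hε2]; linarith)
    rw [← hz] at hzT
    simp only [Finset.forall_mem_union, Finset.forall_mem_image, Finset.mem_filter] at hzT
    have hpos : ∀ C ∈ Δ, ∀ m ∈ s C, 0 < pairing m x → 0 < pairing m z := fun C hC m hm h =>
      hzT.1 ⟨Finset.mem_biUnion.2 ⟨C, hC, hm⟩, h⟩
    have hneg : ∀ C ∈ Δ, ∀ m ∈ s C, pairing m x < 0 → pairing m z < 0 := fun C hC m hm h =>
      neg_pos.1 (hzT.2 ⟨Finset.mem_biUnion.2 ⟨C, hC, hm⟩, h⟩)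
    have hzy : ∀ m : Module.Dual ℤ N, pairing m x = 0 → pairing m z = ε / 2 * pairing m y :=
      fun m hm => by rw [hz, map_add, map_smul, hm, zero_add, smul_eq_mul]
    -- the cone sought is the one with `z` in its relative interior
    have hrel : ∀ C : Δ.filter (x ∈ ·), y ∈ openCell (Z C) (P C) → z ∈ C.1 ∧
        ∀ m ∈ s C.1, (∀ p ∈ C.1, pairing m p = 0) ∨ 0 < pairing m z := by
      intro C hy
      rw [hmem] at hy
      have hxC := (hΔx C).2
      have h1 : ∀ m ∈ s C.1, (∀ p ∈ C.1, pairing m p = 0) ∨ 0 < pairing m z := by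
        intro m hm
        by_cases h0 : ∀ p ∈ C.1, pairing m p = 0
        · exact Or.inl h0
        right
        have hxm : 0 ≤ pairing m x := by
          rw [hs C.1 (hΔx C).1] at hxC
          exact hxC m hm
        rcases hxm.lt_or_eq with h | h
        · exact hpos C.1 (hΔx C).1 m hm h
        · rw [hzy m h.symm]
          exact mul_pos hε2 ((hy m hm).2 h.symm h0)
      refine ⟨?_, h1⟩
      rw [hs C.1 (hΔx C).1]
      intro m hm
      rcases h1 m hm with h | h
      · rw [hzy m (h x hxC), (hy m hm).1 h, mul_zero]
      · exact h.le
    obtain ⟨C, hC, hmin⟩ := Finset.exists_minimal (s := Δ.filter (z ∈ ·)) (by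
      obtain ⟨C, hC, hzC⟩ := hΔ.complete z
      exact ⟨C, Finset.mem_filter.2 ⟨hC, hzC⟩⟩)
    obtain ⟨hCΔ, hzC⟩ := Finset.mem_filter.1 hC
    have hvan : ∀ m ∈ s C, pairing m z = 0 → ∀ p ∈ C, pairing m p = 0 := by
      intro m hm hmz p hp
      have hF : {q | q ∈ C ∧ ∀ m' ∈ ({m} : Finset _), pairing m' q = 0} ∈ Δ.filter (z ∈ ·) :=
        Finset.mem_filter.2 ⟨hΔ.face_mem C hCΔ _
          ⟨s C, {m}, Finset.singleton_subset_iff.2 hm, hs C hCΔ, rfl⟩, hzC, by simpa using hmz⟩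
      exact (hmin hF (fun q hq => hq.1) hp).2 m (Finset.mem_singleton_self m)
    have hzm : ∀ m ∈ s C, 0 ≤ pairing m z := fun m hm => by
      rw [hs C hCΔ] at hzC
      exact hzC m hm
    have hxC : x ∈ C := by
      rw [hs C hCΔ]
      intro m hm
      by_contra h
      exact (hneg C hCΔ m hm (not_le.1 h)).not_ge (hzm m hm)
    have hyC : y ∈ openCell (Z ⟨C, Finset.mem_filter.2 ⟨hCΔ, hxC⟩⟩)
        (P ⟨C, Finset.mem_filter.2 ⟨hCΔ, hxC⟩⟩) := by
      refine (hmem _ y).2 fun m hm => ⟨fun h => ?_, fun hmx h => ?_⟩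
      · have := hzy m (h x hxC)
        rw [h z hzC] at this
        exact (mul_eq_zero.1 this.symm).resolve_left hε2.ne'
      · have h1 : 0 < pairing m z :=
          lt_of_le_of_ne (hzm m hm) fun h0 => h (hvan m hm h0.symm)
        rw [hzy m hmx] at h1
        exact pos_of_mul_pos_right h1 hε2.le
    refine ⟨_, hyC, fun C' hC' => ?_⟩
    have hsub : ∀ C₁ C₂ : Δ.filter (x ∈ ·), y ∈ openCell (Z C₁) (P C₁) →
        y ∈ openCell (Z C₂) (P C₂) → C₁.1 ⊆ C₂.1 := by
      intro C₁ C₂ h₁ h₂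
      obtain ⟨hz₁, hr₁⟩ := hrel C₁ h₁
      obtain ⟨σ, t, htσ, hσ, ht⟩ := (hΔ.inter_isFace C₁.1 (hΔx C₁).1 C₂.1 (hΔx C₂).1).1
      have hz₂ : z ∈ C₁.1 ∩ C₂.1 := ⟨hz₁, (hrel C₂ h₂).1⟩
      intro p hp
      suffices h : p ∈ C₁.1 ∩ C₂.1 from h.2
      rw [ht] at hz₂ ⊢
      refine ⟨hp, fun m hm => ?_⟩
      have hnonneg : ∀ q ∈ C₁.1, 0 ≤ pairing m q := fun q hq => by
        rw [hσ] at hq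
        exact hq m (htσ hm)
      have hmz := hz₂.2 m hm
      have heq := hs C₁.1 (hΔx C₁).1
      refine pairing_eq_zero_of_relint (s := s C₁.1) (z := z) ?_ ?_ hmz ?_ ?_ <;>
        rw [← heq] <;> assumption
    exact Subtype.ext (Set.Subset.antisymm (hsub _ _ hC' hyC) (hsub _ _ hyC hC'))
  have huniv := sum_cellSign_inter Z P hpart (Finset.univ.biUnion fun C => Z C ∪ P C) ∅ ∅
    fun C l hl => Or.inl (Finset.mem_biUnion.2 ⟨C, Finset.mem_univ _, hl⟩)
  have hempty : openCell ∅ ∅ = (Set.univ : Set (ℝ ⊗[ℤ] N)) := by ext; simp [openCell]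
  have hrank : Module.finrank ℝ (ℝ ⊗[ℤ] N) = Module.finrank ℤ N := Module.finrank_baseChange
  simp only [hempty, Set.univ_inter, hdim] at huniv
  rw [cellSign, if_pos Set.univ_nonempty, Submodule.span_univ, finrank_top, hrank] at huniv
  have hsum : ∑ C ∈ Δ with x ∈ C, (-1 : ℤ) ^ coneCodim C =
      (-1) ^ Module.finrank ℤ N * ∑ C : Δ.filter (x ∈ ·), (-1) ^ coneDim C.1 := by
    rw [Finset.mul_sum, Finset.sum_subtype (p := fun C => C ∈ Δ.filter (x ∈ ·)) _ fun _ => Iff.rfl]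
    refine Finset.sum_congr rfl fun C _ => ?_
    have hle : coneDim C.1 ≤ Module.finrank ℤ N := by
      rw [← hrank]; exact Submodule.finrank_le _
    rw [← pow_add, coneCodim]
    have : Module.finrank ℤ N + coneDim C.1 =
        Module.finrank ℤ N - coneDim C.1 + 2 * coneDim C.1 := by omega
    rw [this, pow_add, pow_mul]; simp
  rw [hsum, huniv, ← pow_add, ← two_mul, pow_mul]; simp

end Fans

/-! ### Evaluation of Laurent polynomials -/

section Evaluation

variable {N : Type*} [AddCommGroup N]

/-- Evaluation of Laurent polynomials at the point `x ^ n = q ^ (m · n)`, as an algebra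
homomorphism. -/
def evalHom (q : ℂ) (hq : q ≠ 0) (m : Module.Dual ℤ N) : AddMonoidAlgebra ℂ N →ₐ[ℂ] ℂ :=
  AddMonoidAlgebra.lift ℂ ℂ N
    { toFun := fun n => q ^ m n.toAdd
      map_one' := by simp
      map_mul' := fun a b => by rw [toAdd_mul, map_add, zpow_add₀ hq] }

theorem evalHom_apply (q : ℂ) (hq : q ≠ 0) (m : Module.Dual ℤ N) (P : AddMonoidAlgebra ℂ N) :
    evalHom q hq m P = evalAt q m P := by
  simp [evalHom, evalAt, AddMonoidAlgebra.lift_apply]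

theorem evalHom_single (q : ℂ) (hq : q ≠ 0) (m : Module.Dual ℤ N) (n : N) (c : ℂ) :
    evalHom q hq m (AddMonoidAlgebra.single n c) = c * q ^ m n := by
  simp [evalHom, AddMonoidAlgebra.lift_apply]

theorem evalAt_mul {q : ℂ} (hq : q ≠ 0) (m : Module.Dual ℤ N) (P R : AddMonoidAlgebra ℂ N) :
    evalAt q m (P * R) = evalAt q m P * evalAt q m R := by
  simp only [← evalHom_apply q hq, map_mul]

theorem evalAt_denom {q : ℂ} (hq : q ≠ 0) (m : Module.Dual ℤ N) (D : Finset N) (z : N → ℂ) :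
    evalAt q m (denom D z) = ∏ d ∈ D, (1 - z d * q ^ m d) := by
  rw [← evalHom_apply q hq, denom, map_prod]
  exact Finset.prod_congr rfl fun d _ => by rw [map_sub, map_one, evalHom_single]

theorem hasSum_act {q : ℂ} (hq : q ≠ 0) (m : Module.Dual ℤ N) (A : AddMonoidAlgebra ℂ N)
    {g : N → ℂ} {S : ℂ} (hg : HasSum (fun n => g n * q ^ m n) S) :
    HasSum (fun n => act A g n * q ^ m n) (evalAt q m A * S) := by
  rw [← evalHom_apply q hq]
  induction A using AddMonoidAlgebra.induction_linear with
  | zero => simp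
  | add A B hA hB => simpa [add_mul] using hA.add hB
  | single k c =>
    rw [evalHom_single, ← (Equiv.addRight k).hasSum_iff]
    have : (fun n => act (AddMonoidAlgebra.single k c) g n * q ^ m n) ∘ Equiv.addRight k =
        fun n => c * q ^ m k * (g n * q ^ m n) := by
      funext n
      simp only [Function.comp_apply, Equiv.coe_addRight, act_single, add_sub_cancel_right,
        map_add, zpow_add₀ hq]
      ring
    rw [this]
    exact hg.mul_left _

theorem hasSum_coeff (q : ℂ) (m : Module.Dual ℤ N) (P : AddMonoidAlgebra ℂ N) :
    HasSum (fun n => P.coeff n * q ^ m n) (evalAt q m P) :=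
  hasSum_sum_of_ne_finset_zero fun n hn => by
    rw [Finsupp.notMem_support_iff.1 hn, zero_mul]

/-- A Laurent polynomial that vanishes for all small `q` in a direction `m` that separates its
exponents is zero. -/
theorem eq_zero_of_evalAt_eq_zero (A : AddMonoidAlgebra ℂ N) (m : Module.Dual ℤ N)
    (hm : ∀ n ∈ A.coeff.support, ∀ n' ∈ A.coeff.support, n ≠ n' → m n ≠ m n') {δ : ℝ}
    (hδ : 0 < δ) (h : ∀ q : ℂ, 0 < ‖q‖ → ‖q‖ < δ → evalAt q m A = 0) : A = 0 := by
  by_contra hA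
  have hne : A.coeff.support.Nonempty :=
    Finsupp.support_nonempty_iff.2 fun h0 => hA (AddMonoidAlgebra.coeff_eq_zero.1 h0)
  obtain ⟨n₀, hn₀, hmin⟩ := A.coeff.support.exists_min_image m hne
  -- after division by the lowest power of `q`, the limit at `0` is the lowest coefficient
  let F : ℂ → ℂ := fun q => ∑ n ∈ A.coeff.support, A.coeff n * q ^ (m n - m n₀).toNat
  have hF : Continuous F := by fun_prop
  have hF0 : F 0 = A.coeff n₀ := by
    rw [show F 0 = ∑ n ∈ A.coeff.support, A.coeff n * 0 ^ (m n - m n₀).toNat from rfl,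
      Finset.sum_eq_single_of_mem n₀ hn₀]
    · simp
    · intro n hn hne'
      have h1 := hm n hn n₀ hn₀ hne'
      have h2 := hmin n hn
      rw [zero_pow (by omega), mul_zero]
  have hFq : ∀ q : ℂ, 0 < ‖q‖ → ‖q‖ < δ → F q = 0 := by
    intro q hq0 hqδ
    have hq : q ≠ 0 := norm_pos_iff.1 hq0
    have h1 : F q * q ^ m n₀ = evalAt q m A := by
      rw [evalAt, Finsupp.sum, Finset.sum_mul]
      refine Finset.sum_congr rfl fun n hn => ?_
      have h2 := hmin n hn
      rw [← zpow_natCast, Int.toNat_of_nonneg (by omega), mul_assoc, ← zpow_add₀ hq,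
        sub_add_cancel]
    rw [h q hq0 hqδ] at h1
    exact (mul_eq_zero.1 h1).resolve_right (zpow_ne_zero _ hq)
  have hlim : Filter.Tendsto F (nhdsWithin 0 {0}ᶜ) (nhds (F 0)) :=
    hF.continuousAt.tendsto.mono_left nhdsWithin_le_nhds
  have hlim' : Filter.Tendsto F (nhdsWithin 0 {0}ᶜ) (nhds 0) := by
    refine tendsto_const_nhds.congr' ?_
    filter_upwards [self_mem_nhdsWithin,
      nhdsWithin_le_nhds (Metric.ball_mem_nhds (0 : ℂ) hδ)] with q hq hqδ
    exact (hFq q (norm_pos_iff.2 hq) (by simpa using hqδ)).symm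
  have := tendsto_nhds_unique hlim hlim'
  rw [hF0] at this
  exact Finsupp.mem_support_iff.1 hn₀ this

end Evaluation

/-! ### Convergence of the sums over lattice points -/

section Summability

/-- The series of `2 ^ (-‖a‖₁)` over `a ∈ ℤ ^ ι` converges: its partial sums are bounded by a power
of a geometric series. -/
theorem summable_half_pow_l1 (ι : Type*) [Fintype ι] :
    Summable fun a : ι → ℤ => (1 / 2 : ℝ) ^ ∑ i, (a i).natAbs := by
  classical
  have hf : Summable fun k : ℤ => (1 / 2 : ℝ) ^ k.natAbs :=
    Summable.of_nat_of_neg (by simpa using summable_geometric_two)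
      (by simpa using summable_geometric_two)
  refine summable_of_sum_le (c := ∏ _i : ι, ∑' k : ℤ, (1 / 2 : ℝ) ^ k.natAbs)
    (fun a => by positivity) fun u => ?_
  calc ∑ a ∈ u, (1 / 2 : ℝ) ^ ∑ i, (a i).natAbs
      ≤ ∑ a ∈ Fintype.piFinset fun i => u.image fun a => a i,
          (1 / 2 : ℝ) ^ ∑ i, (a i).natAbs :=
        Finset.sum_le_sum_of_subset_of_nonneg
          (fun a ha => Fintype.mem_piFinset.2 fun i => Finset.mem_image_of_mem _ ha)
          fun _ _ _ => by positivity
    _ = ∏ i, ∑ k ∈ u.image fun a => a i, (1 / 2 : ℝ) ^ k.natAbs := by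
        rw [Finset.prod_univ_sum]
        exact Finset.sum_congr rfl fun a _ => (Finset.prod_pow_eq_pow_sum _ _ _).symm
    _ ≤ _ := Finset.prod_le_prod (fun i _ => Finset.sum_nonneg fun _ _ => by positivity)
        fun i _ => hf.sum_le_tsum _ fun _ _ => by positivity

variable {N : Type*} [AddCommGroup N] [Module.Free ℤ N] [Module.Finite ℤ N]
  {Δ : Finset (Set (ℝ ⊗[ℤ] N))}

theorem summable_norm_term (hΔ : IsCompleteFan Δ) {deg : N → ℂ} (hdeg : IsDegreeFunction Δ deg)
    {C : Set (ℝ ⊗[ℤ] N)} (hC : C ∈ Δ) {m : Module.Dual ℤ N}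
    (hm : ∀ x ∈ C, x ≠ 0 → 0 < pairing m x) :
    ∃ δ : ℝ, 0 < δ ∧ ∀ q : ℂ, 0 < ‖q‖ → ‖q‖ < δ →
      Summable fun n : latticePoints C => ‖term deg q m n‖ := by
  let b := Module.Free.chooseBasis ℤ N
  obtain ⟨l, hl⟩ := hdeg C hC
  choose A hA using fun i => exists_abs_le_mul hΔ hC hm (b.coord i)
  set c : N → ℝ := fun n => (2 * Real.pi * Complex.I * l n).re with hc
  set B : ℝ := ∑ i, |c (b i)| * A i with hB
  have hB0 : 0 ≤ B := Finset.sum_nonneg fun i _ => by positivity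
  have hmn : ∀ n ∈ latticePoints C, 0 ≤ m n := by
    intro n hn
    rcases eq_or_ne (toReal n) 0 with h | h
    · simp [toReal_eq_zero h]
    · have := hm _ hn h
      rw [pairing_toReal] at this
      exact_mod_cast this.le
  have hcn : ∀ n ∈ latticePoints C, c n ≤ B * m n := by
    intro n hn
    have h1 : c n = ∑ i, (b.repr n i : ℝ) * c (b i) := by
      simp only [hc]
      conv_lhs => rw [← b.sum_repr n]
      rw [map_sum, Finset.mul_sum, Complex.re_sum]
      refine Finset.sum_congr rfl fun i _ => ?_
      rw [map_smul, zsmul_eq_mul, mul_left_comm, ← Complex.ofReal_intCast, Complex.re_ofReal_mul]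
    rw [h1, hB, Finset.sum_mul]
    refine Finset.sum_le_sum fun i _ => (le_abs_self _).trans ?_
    rw [abs_mul, mul_comm, mul_assoc]
    refine mul_le_mul_of_nonneg_left ?_ (abs_nonneg _)
    have := hA i n hn
    rw [Module.Basis.coord_apply] at this
    exact_mod_cast this
  set a : ℕ := ∑ i, A i with ha
  have han : ∀ n ∈ latticePoints C, ∑ i, (b.equivFun n i).natAbs ≤ a * (m n).toNat := by
    intro n hn
    rw [ha, Finset.sum_mul]
    refine Finset.sum_le_sum fun i _ => ?_
    have h1 := hA i n hn
    rw [Module.Basis.coord_apply] at h1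
    have h2 := hmn n hn
    zify
    rw [Int.toNat_of_nonneg h2]
    exact h1
  refine ⟨Real.exp (-B) * (1 / 2) ^ a, by positivity, fun q hq0 hq => ?_⟩
  have hsum : Summable fun n : latticePoints C =>
      (1 / 2 : ℝ) ^ ∑ i, (b.equivFun n.1 i).natAbs :=
    (summable_half_pow_l1 _).comp_injective
      (i := fun n : latticePoints C => (b.equivFun n.1 : _ → ℤ))
      (b.equivFun.injective.comp Subtype.val_injective)
  refine Summable.of_nonneg_of_le (fun _ => norm_nonneg _) (fun n => ?_) hsum
  obtain ⟨n, hn⟩ := n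
  obtain ⟨k, hk⟩ := Int.eq_ofNat_of_zero_le (hmn n hn)
  have h1 := hcn n hn
  have h2 := han n hn
  rw [hk] at h1 h2
  simp only [Int.toNat_natCast, Int.cast_natCast] at h1 h2
  simp only [term, norm_mul, hk, zpow_natCast, norm_pow, Complex.norm_exp, hl n hn]
  calc ‖q‖ ^ k * Real.exp (c n) ≤ ‖q‖ ^ k * Real.exp (B * k) := by gcongr
    _ = (‖q‖ * Real.exp B) ^ k := by rw [mul_pow, ← Real.exp_nat_mul, mul_comm B]
    _ ≤ ((1 / 2) ^ a) ^ k := by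
        refine pow_le_pow_left₀ (by positivity) ?_ k
        have h3 := mul_le_mul_of_nonneg_right hq.le (Real.exp_pos B).le
        rwa [mul_right_comm, ← Real.exp_add, neg_add_cancel, Real.exp_zero, one_mul] at h3
    _ = (1 / 2) ^ (a * k) := (pow_mul _ _ _).symm
    _ ≤ _ := pow_le_pow_of_le_one (by norm_num) (by norm_num) h2

end Summability

/-! ### The values of the continued sums -/

section Values

variable {N : Type*} [AddCommGroup N] [Module.Free ℤ N] {Δ : Finset (Set (ℝ ⊗[ℤ] N))}

/-- The directions that are positive on a cone of the fan separate the exponents of any Laurent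
polynomial. -/
theorem exists_pos_separating (hΔ : IsCompleteFan Δ) {C : Set (ℝ ⊗[ℤ] N)} (hC : C ∈ Δ)
    (s : Finset N) : ∃ m : Module.Dual ℤ N, (∀ x ∈ C, x ≠ 0 → 0 < pairing m x) ∧
      ∀ n ∈ s, ∀ n' ∈ s, n ≠ n' → m n ≠ m n' := by
  classical
  obtain ⟨m₀, hm₀⟩ := (hΔ.isCone C hC).exists_pos
  let S : Finset N := (s ×ˢ s).image fun p => p.1 - p.2
  obtain ⟨m₁, hm₁⟩ := exists_forall_ne_zero (S.image (Module.Dual.eval ℤ N))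
  set K : ℤ := 1 + ∑ n ∈ S ∪ raysIn Δ C, |m₁ n| with hK
  have hKn : ∀ n ∈ S ∪ raysIn Δ C, |m₁ n| < K := by
    intro n hn
    have := Finset.single_le_sum (f := fun n => |m₁ n|) (fun _ _ => abs_nonneg _) hn
    linarith
  have heval : ∀ n : N, n ≠ 0 → Module.Dual.eval ℤ N n ≠ 0 := by
    intro n hn h
    exact hn (Module.eval_apply_injective ℤ (by rw [h, map_zero]))
  refine ⟨m₁ + K • m₀, fun x hx hx0 => ?_, fun n hn n' hn' hne h => ?_⟩
  · have hray : ∀ d ∈ raysIn Δ C, 0 < (m₁ + K • m₀) d := by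
      intro d hd
      have h1 := hm₀ _ (mem_raysIn.1 hd).2 fun h0 =>
        (mem_raysIn.1 hd).1.ne_zero (toReal_eq_zero h0)
      rw [pairing_toReal] at h1
      have h2 : 0 < m₀ d := by exact_mod_cast h1
      have h3 := hKn d (Finset.mem_union_right _ hd)
      have h4 := (abs_lt.1 h3).1
      have h5 := (abs_nonneg _).trans_lt h3
      rw [LinearMap.add_apply, LinearMap.smul_apply, smul_eq_mul]
      nlinarith
    obtain ⟨t, ht, rfl⟩ := exists_eq_sum_rays hΔ hC hx
    simp only [map_sum, map_smul, smul_eq_mul, pairing_toReal]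
    obtain ⟨d, hd, hd0⟩ := Finset.exists_ne_zero_of_sum_ne_zero hx0
    have htd : 0 < t d := lt_of_le_of_ne (ht d) fun h => hd0 (by rw [← h, zero_smul])
    exact Finset.sum_pos'
      (fun e he => mul_nonneg (ht e) (by exact_mod_cast (hray e he).le))
      ⟨d, hd, mul_pos htd (by exact_mod_cast hray d hd)⟩
  · have hS : n - n' ∈ S := Finset.mem_image.2 ⟨(n, n'), Finset.mk_mem_product hn hn', rfl⟩
    have h1 : m₁ (n - n') ≠ 0 :=
      hm₁ _ (Finset.mem_image_of_mem _ hS) (heval _ (sub_ne_zero.2 hne))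
    refine add_mul_ne_zero_of_abs_lt (hKn _ (Finset.mem_union_left _ hS)) (Or.inl h1)
      (b := m₀ (n - n')) ?_
    have h2 : (m₁ + K • m₀) (n - n') = 0 := by rw [map_sub, h, sub_self]
    simpa using h2

/-- Any two rational functions that represent the sums over a cone agree. -/
theorem RepresentsSum.mul_eq_mul (hΔ : IsCompleteFan Δ) {deg : N → ℂ} {C : Set (ℝ ⊗[ℤ] N)}
    (hC : C ∈ Δ) {P Q P' Q' : AddMonoidAlgebra ℂ N} (h : RepresentsSum C deg P Q)
    (h' : RepresentsSum C deg P' Q') : P' * Q = P * Q' := by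
  rw [← sub_eq_zero]
  obtain ⟨m, hm, hsep⟩ := exists_pos_separating hΔ hC (P' * Q - P * Q').coeff.support
  obtain ⟨δ, hδ, hq⟩ := h.2 m hm
  obtain ⟨δ', hδ', hq'⟩ := h'.2 m hm
  refine eq_zero_of_evalAt_eq_zero _ m hsep (lt_min hδ hδ') fun q hq0 hqlt => ?_
  have h0 : q ≠ 0 := norm_pos_iff.1 hq0
  have e := (hq q hq0 (hqlt.trans_le (min_le_left _ _))).2
  have e' := (hq' q hq0 (hqlt.trans_le (min_le_right _ _))).2
  rw [← evalHom_apply q h0, map_sub, evalHom_apply, evalHom_apply, evalAt_mul h0, evalAt_mul h0,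
    ← e, ← e']
  ring

/-- At `q ≠ 0` none of the factors of the denominators of the fan vanishes, in any direction
`m`. -/
def IsRegularAt (Δ : Finset (Set (ℝ ⊗[ℤ] N))) (deg : N → ℂ) (q : ℂ) : Prop :=
  q ≠ 0 ∧ ∀ (m : Module.Dual ℤ N), ∀ d ∈ rays Δ, 1 - expDeg deg d * q ^ m d ≠ 0

theorem IsRegularAt.evalAt_denom_ne_zero {deg : N → ℂ} {q : ℂ} (hq : IsRegularAt Δ deg q)
    {D : Finset N} (hD : D ⊆ rays Δ) (m : Module.Dual ℤ N) :
    evalAt q m (denom D (expDeg deg)) ≠ 0 := by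
  rw [evalAt_denom hq.1, Finset.prod_ne_zero_iff]
  exact fun d hd => hq.2 m d (hD hd)

variable [Module.Finite ℤ N]

theorem representsSum_cone (hΔ : IsCompleteFan Δ) {deg : N → ℂ} (hdeg : IsDegreeFunction Δ deg)
    {C : Set (ℝ ⊗[ℤ] N)} (hC : C ∈ Δ) {R : AddMonoidAlgebra ℂ N}
    (hR : act (denom (raysIn Δ C) (expDeg deg)) ((latticePoints C).indicator (expDeg deg)) =
      R.coeff)
    (h0 : denom (raysIn Δ C) (expDeg deg) ≠ 0) :
    RepresentsSum C deg R (denom (raysIn Δ C) (expDeg deg)) := by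
  refine ⟨h0, fun m hm => ?_⟩
  obtain ⟨δ, hδ, hsum⟩ := summable_norm_term hΔ hdeg hC hm
  refine ⟨δ, hδ, fun q hq0 hqδ => ⟨hsum q hq0 hqδ, ?_⟩⟩
  have hq : q ≠ 0 := norm_pos_iff.1 hq0
  have hS : HasSum ((latticePoints C).indicator (term deg q m))
      (∑' n : latticePoints C, term deg q m n) :=
    hasSum_subtype_iff_indicator.1 (hsum q hq0 hqδ).of_norm.hasSum
  have hind : (latticePoints C).indicator (term deg q m) =
      fun n => (latticePoints C).indicator (expDeg deg) n * q ^ m n := by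
    funext n
    by_cases hn : n ∈ latticePoints C <;> simp [hn, term, expDeg, mul_comm]
  rw [hind] at hS
  have := hasSum_act hq m (denom (raysIn Δ C) (expDeg deg)) hS
  rw [hR] at this
  exact this.unique (hasSum_coeff q m R)

theorem isContinuedValue_iff (hΔ : IsCompleteFan Δ) {deg : N → ℂ} (hdeg : IsDegreeFunction Δ deg)
    {C : Set (ℝ ⊗[ℤ] N)} (hC : C ∈ Δ) {R : AddMonoidAlgebra ℂ N}
    (hR : act (denom (raysIn Δ C) (expDeg deg)) ((latticePoints C).indicator (expDeg deg)) =
      R.coeff)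
    {q : ℂ} (hq : IsRegularAt Δ deg q) (m : Module.Dual ℤ N) (v : ℂ) :
    IsContinuedValue C deg q m v ↔
      v = evalAt q m R / evalAt q m (denom (raysIn Δ C) (expDeg deg)) := by
  have hne := hq.evalAt_denom_ne_zero (raysIn_subset C) m
  have hrep := representsSum_cone hΔ hdeg hC hR fun h0 => hne (by rw [h0]; simp [evalAt])
  refine ⟨?_, fun hv => ⟨R, _, hrep, hne, hv⟩⟩
  rintro ⟨P, Q, hPQ, hQ, rfl⟩
  have := congrArg (evalAt q m) (hrep.mul_eq_mul hΔ hC hPQ)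
  rw [evalAt_mul hq.1, evalAt_mul hq.1] at this
  rw [div_eq_div_iff hQ hne, this]

/-- The function `r(q, m)` is the value of the rational function that represents the formal series
of all `exp (2 π i deg n) x ^ n`. -/
theorem rTerm_mul_evalAt_denom (hΔ : IsCompleteFan Δ) {deg : N → ℂ}
    (hdeg : IsDegreeFunction Δ deg) {P : AddMonoidAlgebra ℂ N}
    (hP : act (denom (rays Δ) (expDeg deg)) (expDeg deg) = P.coeff)
    {q : ℂ} (hq : IsRegularAt Δ deg q) (m : Module.Dual ℤ N) :
    rTerm Δ deg q m * evalAt q m (denom (rays Δ) (expDeg deg)) = evalAt q m P := by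
  classical
  choose! R hR using fun C (hC : C ∈ Δ) => exists_numerator_cone hΔ hdeg hC
  have hval : ∀ C ∈ Δ, fCone C deg q m * evalAt q m (denom (rays Δ) (expDeg deg)) =
      evalAt q m (denom (rays Δ \ raysIn Δ C) (expDeg deg) * R C) := by
    intro C hC
    have hex : ∃ v, IsContinuedValue C deg q m v :=
      ⟨_, (isContinuedValue_iff hΔ hdeg hC (hR C hC) hq m _).2 rfl⟩
    have hne := hq.evalAt_denom_ne_zero (raysIn_subset (Δ := Δ) C) m
    have hf := (isContinuedValue_iff hΔ hdeg hC (hR C hC) hq m _).1 hex.choose_spec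
    rw [fCone, dif_pos hex, hf, ← denom_mul_denom_sdiff (raysIn_subset C), evalAt_mul hq.1,
      evalAt_mul hq.1]
    field_simp
  have hseries : expDeg deg = ∑ C ∈ Δ, (-1 : ℂ) ^ coneCodim C •
      (latticePoints C).indicator (expDeg deg) := by
    funext n
    have h1 := congrArg (fun k : ℤ => (k : ℂ) * expDeg deg n)
      (sum_neg_one_pow_coneCodim hΔ (toReal n))
    simp only [Int.cast_one, one_mul, Int.cast_sum, Int.cast_pow, Int.cast_neg] at h1
    rw [← h1, Finset.sum_apply, Finset.sum_filter, Finset.sum_mul]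
    refine Finset.sum_congr rfl fun C _ => ?_
    rw [Pi.smul_apply, smul_eq_mul]
    by_cases hn : toReal n ∈ C
    · rw [if_pos hn, Set.indicator_of_mem (s := latticePoints C) hn]
    · rw [if_neg hn, Set.indicator_of_notMem (s := latticePoints C) hn]; simp
  have hPsum : P = ∑ C ∈ Δ, (-1 : ℂ) ^ coneCodim C •
      (denom (rays Δ \ raysIn Δ C) (expDeg deg) * R C) := by
    refine AddMonoidAlgebra.coeff_injective (DFunLike.coe_injective ?_)
    have h1 := congrArg (act (denom (rays Δ) (expDeg deg))) hseries
    rw [map_sum, hP] at h1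
    rw [h1, AddMonoidAlgebra.coeff_sum, Finsupp.coe_finsetSum]
    refine Finset.sum_congr rfl fun C hC => ?_
    rw [map_smul, ← denom_mul_denom_sdiff (raysIn_subset C), act_mul, hR C hC, act_coeff]
    rfl
  rw [hPsum, ← evalHom_apply q hq.1, ← evalHom_apply q hq.1, map_sum, rTerm, Finset.sum_mul]
  refine Finset.sum_congr rfl fun C hC => ?_
  rw [map_smul, evalHom_apply, evalHom_apply, ← hval C hC, smul_eq_mul, mul_assoc]

end Values

/-! ### Expansions in powers of `q` -/

section PowerSeries

/-- The power series `a` converges absolutely at `q`, with sum `v`. -/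
def ConvergesTo (a : PowerSeries ℂ) (q v : ℂ) : Prop :=
  (Summable fun k : ℕ => ‖PowerSeries.coeff k a * q ^ k‖) ∧
    HasSum (fun k : ℕ => PowerSeries.coeff k a * q ^ k) v

theorem ConvergesTo.mul {a b : PowerSeries ℂ} {q v w : ℂ} (ha : ConvergesTo a q v)
    (hb : ConvergesTo b q w) : ConvergesTo (a * b) q (v * w) := by
  have hcoeff : ∀ k : ℕ, PowerSeries.coeff k (a * b) * q ^ k =
      ∑ p ∈ Finset.HasAntidiagonal.antidiagonal k, (PowerSeries.coeff p.1 a * q ^ p.1) *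
        (PowerSeries.coeff p.2 b * q ^ p.2) := by
    intro k
    rw [PowerSeries.coeff_mul, Finset.sum_mul]
    refine Finset.sum_congr rfl fun p hp => ?_
    rw [← Finset.HasAntidiagonal.mem_antidiagonal.1 hp, pow_add]
    ring
  have hsum := summable_norm_sum_mul_antidiagonal_of_summable_norm ha.1 hb.1
  have hval := tsum_mul_tsum_eq_tsum_sum_antidiagonal_of_summable_norm ha.1 hb.1
  rw [ha.2.tsum_eq, hb.2.tsum_eq] at hval
  unfold ConvergesTo
  simp_rw [hcoeff, hval]
  exact ⟨hsum, hsum.of_norm.hasSum⟩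

theorem convergesTo_C (c q : ℂ) : ConvergesTo (PowerSeries.C c) q c := by
  have h : ∀ k ∉ ({0} : Finset ℕ), PowerSeries.coeff k (PowerSeries.C c) * q ^ k = 0 := by
    intro k hk
    rw [PowerSeries.coeff_C, if_neg (by simpa using hk), zero_mul]
  refine ⟨summable_of_ne_finset_zero (s := {0}) fun k hk => by rw [h k hk, norm_zero], ?_⟩
  simpa using hasSum_sum_of_ne_finset_zero h

theorem convergesTo_X_pow (e : ℕ) (q : ℂ) : ConvergesTo (PowerSeries.X ^ e) q (q ^ e) := by
  have h : ∀ k ∉ ({e} : Finset ℕ),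
      PowerSeries.coeff k (PowerSeries.X ^ e : PowerSeries ℂ) * q ^ k = 0 := by
    intro k hk
    rw [PowerSeries.coeff_X_pow, if_neg (by simpa using hk), zero_mul]
  refine ⟨summable_of_ne_finset_zero (s := {e}) fun k hk => by rw [h k hk, norm_zero], ?_⟩
  simpa [PowerSeries.coeff_X_pow] using hasSum_sum_of_ne_finset_zero h

theorem ConvergesTo.add {a b : PowerSeries ℂ} {q v w : ℂ} (ha : ConvergesTo a q v)
    (hb : ConvergesTo b q w) : ConvergesTo (a + b) q (v + w) := by
  simp only [ConvergesTo, map_add, add_mul]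
  exact ⟨Summable.of_nonneg_of_le (fun _ => norm_nonneg _) (fun _ => norm_add_le _ _)
    (ha.1.add hb.1), ha.2.add hb.2⟩

theorem convergesTo_sum {ι : Type*} (s : Finset ι) {a : ι → PowerSeries ℂ} {q : ℂ} {v : ι → ℂ}
    (h : ∀ i ∈ s, ConvergesTo (a i) q (v i)) : ConvergesTo (∑ i ∈ s, a i) q (∑ i ∈ s, v i) := by
  classical
  induction s using Finset.induction_on with
  | empty => simpa using convergesTo_C 0 q
  | insert i s hi ih =>
    rw [Finset.sum_insert hi, Finset.sum_insert hi]
    exact (h i (by simp)).add (ih fun j hj => h j (Finset.mem_insert_of_mem hj))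

theorem convergesTo_prod {ι : Type*} (s : Finset ι) {a : ι → PowerSeries ℂ} {q : ℂ} {v : ι → ℂ}
    (h : ∀ i ∈ s, ConvergesTo (a i) q (v i)) : ConvergesTo (∏ i ∈ s, a i) q (∏ i ∈ s, v i) := by
  classical
  induction s using Finset.induction_on with
  | empty => simpa using convergesTo_C 1 q
  | insert i s hi ih =>
    rw [Finset.prod_insert hi, Finset.prod_insert hi]
    exact (h i (by simp)).mul (ih fun j hj => h j (Finset.mem_insert_of_mem hj))

/-- The geometric series in `c q ^ k`, as a power series in `q`. -/
theorem exists_convergesTo_geometric (c : ℂ) {k : ℕ} (hk : k ≠ 0) :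
    ∃ a : PowerSeries ℂ, ∀ q : ℂ, ‖c * q ^ k‖ < 1 → ConvergesTo a q (1 - c * q ^ k)⁻¹ := by
  classical
  refine ⟨PowerSeries.mk fun j => if k ∣ j then c ^ (j / k) else 0, fun q hq => ?_⟩
  have hinj : Function.Injective fun j : ℕ => k * j := fun i j h =>
    Nat.eq_of_mul_eq_mul_left (Nat.pos_of_ne_zero hk) h
  have hzero : ∀ j ∉ Set.range fun j : ℕ => k * j,
      (if k ∣ j then c ^ (j / k) else 0) * q ^ j = 0 := by
    intro j hj
    rw [if_neg, zero_mul]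
    rintro ⟨i, rfl⟩
    exact hj ⟨i, rfl⟩
  have hcomp : ∀ j : ℕ, (if k ∣ k * j then c ^ (k * j / k) else 0) * q ^ (k * j) =
      (c * q ^ k) ^ j := by
    intro j
    rw [if_pos (dvd_mul_right k j), Nat.mul_div_cancel_left _ (Nat.pos_of_ne_zero hk), mul_pow,
      pow_mul]
  simp only [ConvergesTo, PowerSeries.coeff_mk]
  constructor
  · rw [← hinj.summable_iff fun j hj => by rw [hzero j hj, norm_zero]]
    simp only [Function.comp_def, hcomp, norm_pow]
    exact summable_geometric_of_lt_one (norm_nonneg _) hq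
  · rw [← hinj.hasSum_iff hzero]
    simp only [Function.comp_def, hcomp]
    exact hasSum_geometric_of_norm_lt_one hq

theorem norm_inv_one_sub_le {x : ℂ} (hx : ‖x‖ ≤ 1 / 2) : ‖(1 - x)⁻¹‖ ≤ 2 := by
  have h1 : (1 / 2 : ℝ) ≤ ‖1 - x‖ := by
    have := norm_sub_norm_le (1 : ℂ) x
    rw [norm_one] at this
    linarith
  rw [norm_inv]
  calc ‖1 - x‖⁻¹ ≤ (1 / 2 : ℝ)⁻¹ := inv_anti₀ (by norm_num) h1
    _ = 2 := by norm_num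

/-- Expansion at `q = 0` of a factor `1 / (1 - z q ^ j)` of the denominator, for all integers `j`:
up to the power `q ^ max 0 (-j)` it is a power series that is bounded independently of `j`. -/
theorem exists_expansion_factor {z : ℂ} (hz0 : z ≠ 0) (hz1 : z ≠ 1) {ε : ℝ} (hε1 : ε ≤ 1)
    (hε : ‖z‖ * ε ≤ 1 / 2) (hε' : ‖z⁻¹‖ * ε ≤ 1 / 2) (j : ℤ) :
    ∃ (a : PowerSeries ℂ) (v : ℂ → ℂ), ∀ q : ℂ, 0 < ‖q‖ → ‖q‖ < ε →
      ConvergesTo a q (v q) ∧ ‖v q‖ ≤ 2 + 2 * ‖z⁻¹‖ + ‖(1 - z)⁻¹‖ ∧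
      q ^ max 0 (-j) * v q * (1 - z * q ^ j) = 1 := by
  have hsmall : ∀ (c : ℂ) (k : ℕ) (q : ℂ), k ≠ 0 → ‖c‖ * ε ≤ 1 / 2 → ‖q‖ < ε →
      ‖c * q ^ k‖ ≤ 1 / 2 := by
    intro c k q hk hc hq
    rw [norm_mul, norm_pow]
    have h1 : ‖q‖ ^ k ≤ ‖q‖ := pow_le_of_le_one (norm_nonneg _) (hq.le.trans hε1) hk
    exact (mul_le_mul_of_nonneg_left (h1.trans hq.le) (norm_nonneg _)).trans hc
  have hne : ∀ x : ℂ, ‖x‖ ≤ 1 / 2 → 1 - x ≠ 0 := by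
    intro x hx h
    rw [← sub_eq_zero.1 h, norm_one] at hx
    norm_num at hx
  rcases lt_trichotomy j 0 with hj | rfl | hj
  · obtain ⟨k, rfl⟩ : ∃ k : ℕ, j = -(k : ℤ) := ⟨j.natAbs, by omega⟩
    have hk : k ≠ 0 := by omega
    obtain ⟨a, ha⟩ := exists_convergesTo_geometric z⁻¹ hk
    refine ⟨PowerSeries.C (-z⁻¹) * a, fun q => -z⁻¹ * (1 - z⁻¹ * q ^ k)⁻¹, fun q hq0 hq => ?_⟩
    have hs := hsmall z⁻¹ k q hk hε' hq
    refine ⟨(convergesTo_C _ q).mul (ha q (hs.trans_lt (by norm_num))), ?_, ?_⟩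
    · rw [norm_mul, norm_neg]
      have := mul_le_mul_of_nonneg_left (norm_inv_one_sub_le hs) (norm_nonneg z⁻¹)
      linarith [norm_nonneg (1 - z)⁻¹]
    · have hq : q ^ k ≠ 0 := pow_ne_zero _ (norm_pos_iff.1 hq0)
      have hn := hne _ hs
      rw [neg_neg, max_eq_right (by positivity), zpow_neg, zpow_natCast]
      have hn' : z - q ^ k ≠ 0 := by
        intro h
        apply hn
        rw [← sub_eq_zero.1 h, inv_mul_cancel₀ hz0, sub_self]
      have : 1 - z⁻¹ * q ^ k = z⁻¹ * (z - q ^ k) := by field_simp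
      simp only [this]
      field_simp
      ring
  · refine ⟨PowerSeries.C (1 - z)⁻¹, fun _ => (1 - z)⁻¹, fun q _ _ =>
      ⟨convergesTo_C _ q, by linarith [norm_nonneg z⁻¹], ?_⟩⟩
    have : 1 - z ≠ 0 := sub_ne_zero.2 hz1.symm
    simp [this]
  · obtain ⟨k, rfl⟩ : ∃ k : ℕ, j = (k : ℤ) := ⟨j.natAbs, by omega⟩
    have hk : k ≠ 0 := by omega
    obtain ⟨a, ha⟩ := exists_convergesTo_geometric z hk
    refine ⟨a, fun q => (1 - z * q ^ k)⁻¹, fun q hq0 hq => ?_⟩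
    have hs := hsmall z k q hk hε hq
    refine ⟨ha q (hs.trans_lt (by norm_num)), ?_, ?_⟩
    · linarith [norm_inv_one_sub_le hs, norm_nonneg z⁻¹, norm_nonneg (1 - z)⁻¹]
    · rw [max_eq_left (by omega), zpow_zero, one_mul, zpow_natCast, inv_mul_cancel₀ (hne _ hs)]

end PowerSeries

/-! ### The toric form -/

section ToricForms

variable {N : Type*} [AddCommGroup N] [Module.Free ℤ N] {Δ : Finset (Set (ℝ ⊗[ℤ] N))}

/-- All `r(q, m)` expand in nonnegative powers of `q`, in a common punctured disc, with orders and
bounds that are controlled by the size of `m`. -/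
theorem exists_expansion [Module.Finite ℤ N] {deg : N → ℂ} (h : IsAdmissible Δ deg) {ι : Type*}
    [Fintype ι] (b : Module.Basis ι ℤ N) :
    ∃ (ε : ℝ) (K : ℝ) (L : ℕ) (a : Module.Dual ℤ N → PowerSeries ℂ), 0 < ε ∧
      (∀ q : ℂ, 0 < ‖q‖ → ‖q‖ < ε → IsRegularAt Δ deg q) ∧
      (∀ q : ℂ, 0 < ‖q‖ → ‖q‖ < ε → ∀ m, ConvergesTo (a m) q (rTerm Δ deg q m)) ∧
      (∀ q : ℂ, 0 < ‖q‖ → ‖q‖ < ε → ∀ m,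
        ‖rTerm Δ deg q m‖ ≤ K * (1 / 2) ^ ∑ i, (m (b i)).natAbs) ∧
      ∀ m k, PowerSeries.coeff k (a m) ≠ 0 → ∑ i, (m (b i)).natAbs ≤ L * k := by
  classical
  obtain ⟨hΔ, hdeg, hint⟩ := h
  obtain ⟨P, L, hL, hP, hgrowth⟩ := exists_numerator_growth hΔ hdeg b
  set z := expDeg deg with hzdef
  set S : ℝ := ∑ d ∈ rays Δ, (‖z d‖ + ‖(z d)⁻¹‖) with hS
  have hS0 : 0 ≤ S := Finset.sum_nonneg fun _ _ => by positivity
  set ε : ℝ := min ((1 / 2) ^ L) (1 / (2 * (1 + S))) with hε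
  have hε0 : 0 < ε := lt_min (by positivity) (by positivity)
  have hεL : ε ≤ (1 / 2) ^ L := min_le_left _ _
  have hε1 : ε ≤ 1 := hεL.trans (pow_le_one₀ (by norm_num) (by norm_num))
  have hεS : ∀ x : ℝ, x ≤ S → x * ε ≤ 1 / 2 := by
    intro x hx
    calc x * ε ≤ (1 + S) * ε := by gcongr; linarith
      _ ≤ (1 + S) * (1 / (2 * (1 + S))) := by gcongr; exact min_le_right _ _
      _ = 1 / 2 := by field_simp
  have hzS : ∀ d ∈ rays Δ, ‖z d‖ ≤ S ∧ ‖(z d)⁻¹‖ ≤ S := by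
    intro d hd
    have := Finset.single_le_sum (f := fun d => ‖z d‖ + ‖(z d)⁻¹‖) (fun _ _ => by positivity) hd
    constructor
    · linarith [norm_nonneg (z d)⁻¹]
    · linarith [norm_nonneg (z d)]
  have hfactor : ∀ (d : N) (j : ℤ), ∃ (a : PowerSeries ℂ) (v : ℂ → ℂ), d ∈ rays Δ →
      ∀ q : ℂ, 0 < ‖q‖ → ‖q‖ < ε → ConvergesTo a q (v q) ∧
        ‖v q‖ ≤ 2 + 2 * ‖(z d)⁻¹‖ + ‖(1 - z d)⁻¹‖ ∧
        q ^ max 0 (-j) * v q * (1 - z d * q ^ j) = 1 := by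
    intro d j
    by_cases hd : d ∈ rays Δ
    · obtain ⟨a, v, hav⟩ := exists_expansion_factor (expDeg_ne_zero deg d)
        (expDeg_ne_one (hint d (mem_rays.1 hd))) hε1 (hεS _ (hzS d hd).1) (hεS _ (hzS d hd).2) j
      exact ⟨a, v, fun _ => hav⟩
    · exact ⟨0, 0, fun h => absurd h hd⟩
  choose V v hV using hfactor
  set e : Module.Dual ℤ N → N → ℕ := fun m n => (m n + negPart (rays Δ) m).toNat with he
  have hsize : ∀ m n, P.coeff n ≠ 0 →
      ((e m n : ℕ) : ℤ) = m n + negPart (rays Δ) m ∧ ∑ i, (m (b i)).natAbs ≤ L * e m n := by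
    intro m n hn
    have h1 := hgrowth m n hn
    have h2 : 0 ≤ m n + negPart (rays Δ) m := by
      have h3 : 0 ≤ ∑ i, |m (b i)| := Finset.sum_nonneg fun _ _ => abs_nonneg _
      have h4 : (0 : ℤ) < L := by exact_mod_cast Nat.pos_of_ne_zero hL
      exact nonneg_of_mul_nonneg_right (h3.trans h1) h4
    have h3 : ((e m n : ℕ) : ℤ) = m n + negPart (rays Δ) m := Int.toNat_of_nonneg h2
    refine ⟨h3, ?_⟩
    zify
    rw [h3]
    exact h1
  have hreg : ∀ q : ℂ, 0 < ‖q‖ → ‖q‖ < ε → IsRegularAt Δ deg q := fun q hq0 hq =>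
    ⟨norm_pos_iff.1 hq0, fun m d hd h0 => by
      have := (hV d (m d) hd q hq0 hq).2.2
      rw [h0, mul_zero] at this
      exact zero_ne_one this⟩
  have hr : ∀ q : ℂ, 0 < ‖q‖ → ‖q‖ < ε → ∀ m, rTerm Δ deg q m =
      ∑ n ∈ P.coeff.support, q ^ e m n * (P.coeff n * ∏ d ∈ rays Δ, v d (m d) q) := by
    intro q hq0 hq m
    have hq' : q ≠ 0 := norm_pos_iff.1 hq0
    have h1 := rTerm_mul_evalAt_denom hΔ hdeg hP (hreg q hq0 hq) m
    rw [evalAt_denom hq'] at h1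
    have h2 : q ^ negPart (rays Δ) m * (∏ d ∈ rays Δ, v d (m d) q) *
        ∏ d ∈ rays Δ, (1 - z d * q ^ m d) = 1 := by
      rw [← prod_zpow_max hq', ← Finset.prod_mul_distrib, ← Finset.prod_mul_distrib]
      exact Finset.prod_eq_one fun d hd => (hV d (m d) hd q hq0 hq).2.2
    calc rTerm Δ deg q m = rTerm Δ deg q m * (∏ d ∈ rays Δ, (1 - z d * q ^ m d)) *
          (q ^ negPart (rays Δ) m * ∏ d ∈ rays Δ, v d (m d) q) := by
          rw [mul_assoc, mul_comm (∏ d ∈ rays Δ, (1 - z d * q ^ m d)), h2, mul_one]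
      _ = _ := by
          rw [h1, evalAt, Finsupp.sum, Finset.sum_mul]
          refine Finset.sum_congr rfl fun n hn => ?_
          rw [← zpow_natCast, (hsize m n (Finsupp.mem_support_iff.1 hn)).1, zpow_add₀ hq']
          ring
  set B : ℝ := ∏ d ∈ rays Δ, (2 + 2 * ‖(z d)⁻¹‖ + ‖(1 - z d)⁻¹‖) with hB
  have hB0 : 0 ≤ B := Finset.prod_nonneg fun _ _ => by positivity
  refine ⟨ε, ∑ n ∈ P.coeff.support, ‖P.coeff n‖ * B, L,
    fun m => ∑ n ∈ P.coeff.support, PowerSeries.X ^ e m n *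
      (PowerSeries.C (P.coeff n) * ∏ d ∈ rays Δ, V d (m d)), hε0, hreg, ?_, ?_, ?_⟩
  · intro q hq0 hq m
    rw [hr q hq0 hq m]
    exact convergesTo_sum _ fun n _ => (convergesTo_X_pow _ q).mul ((convergesTo_C _ q).mul
      (convergesTo_prod _ fun d hd => (hV d (m d) hd q hq0 hq).1))
  · intro q hq0 hq m
    rw [hr q hq0 hq m, Finset.sum_mul]
    refine (norm_sum_le _ _).trans (Finset.sum_le_sum fun n hn => ?_)
    rw [norm_mul, norm_mul, norm_pow, norm_prod, mul_comm]
    have h1 : ∏ d ∈ rays Δ, ‖v d (m d) q‖ ≤ B :=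
      Finset.prod_le_prod (fun _ _ => norm_nonneg _) fun d hd => (hV d (m d) hd q hq0 hq).2.1
    have h2 : ‖q‖ ^ e m n ≤ (1 / 2) ^ ∑ i, (m (b i)).natAbs := calc
      ‖q‖ ^ e m n ≤ ((1 / 2) ^ L) ^ e m n :=
        pow_le_pow_left₀ (norm_nonneg _) (hq.le.trans hεL) _
      _ = (1 / 2) ^ (L * e m n) := (pow_mul _ _ _).symm
      _ ≤ _ := pow_le_pow_of_le_one (by norm_num) (by norm_num)
        (hsize m n (Finsupp.mem_support_iff.1 hn)).2
    gcongr
  · intro m k hk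
    rw [map_sum] at hk
    obtain ⟨n, hn, hnk⟩ := Finset.exists_ne_zero_of_sum_ne_zero hk
    rw [PowerSeries.coeff_X_pow_mul'] at hnk
    have h1 : e m n ≤ k := by
      by_contra h1
      exact hnk (if_neg h1)
    exact (hsize m n (Finsupp.mem_support_iff.1 hn)).2.trans (Nat.mul_le_mul_left L h1)

/-- The functions `r(q, m)` do not depend on the fan: both denominators clear the same formal
series. -/
theorem rTerm_eq_rTerm [Module.Finite ℤ N] {Δ' : Finset (Set (ℝ ⊗[ℤ] N))} {deg : N → ℂ}
    (h : IsAdmissible Δ deg) (h' : IsAdmissible Δ' deg) {q : ℂ} (hq : IsRegularAt Δ deg q)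
    (hq' : IsRegularAt Δ' deg q) (m : Module.Dual ℤ N) :
    rTerm Δ deg q m = rTerm Δ' deg q m := by
  let b := Module.Free.chooseBasis ℤ N
  obtain ⟨P, -, -, hP, -⟩ := exists_numerator_growth h.1 h.2.1 b
  obtain ⟨P', -, -, hP', -⟩ := exists_numerator_growth h'.1 h'.2.1 b
  have key : denom (rays Δ') (expDeg deg) * P = denom (rays Δ) (expDeg deg) * P' := by
    refine AddMonoidAlgebra.coeff_injective (DFunLike.coe_injective ?_)
    rw [← act_coeff, ← act_coeff, ← hP, ← hP', ← act_mul, ← act_mul, mul_comm]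
  have h1 := rTerm_mul_evalAt_denom h.1 h.2.1 hP hq m
  have h2 := rTerm_mul_evalAt_denom h'.1 h'.2.1 hP' hq' m
  have h3 := congrArg (evalAt q m) key
  rw [evalAt_mul hq.1, evalAt_mul hq.1, ← h1, ← h2] at h3
  refine mul_right_cancel₀ (mul_ne_zero (hq.evalAt_denom_ne_zero subset_rfl m)
    (hq'.evalAt_denom_ne_zero subset_rfl m)) ?_
  linear_combination h3

end ToricForms

end ToricForm

end

theorem mainTheorem6 {N : Type*} [AddCommGroup N] [Module.Free ℤ N] [Module.Finite ℤ N]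
    (Δ : Finset (Set (ℝ ⊗[ℤ] N))) (deg : N → ℂ) (hΔ : ToricForm.IsAdmissible Δ deg) :
    (∃ ε : ℝ, 0 < ε ∧
      -- every `f_C(q, m)` is regular, with a uniquely determined value
      (∀ C ∈ Δ, ∀ q : ℂ, 0 < ‖q‖ → ‖q‖ < ε → ∀ m : Module.Dual ℤ N,
        ∃! v : ℂ, ToricForm.IsContinuedValue C deg q m v) ∧
      -- the sum over `M` converges absolutely and uniformly
      (∀ q : ℂ, 0 < ‖q‖ → ‖q‖ < ε →
        Summable fun m : Module.Dual ℤ N => ‖ToricForm.rTerm Δ deg q m‖) ∧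
      HasSumUniformlyOn (fun (m : Module.Dual ℤ N) (q : ℂ) => ToricForm.rTerm Δ deg q m)
        (ToricForm.toricForm Δ deg) {q : ℂ | 0 < ‖q‖ ∧ ‖q‖ < ε} ∧
      -- the expansions in nonnegative powers of `q`
      ∃ a : Module.Dual ℤ N → PowerSeries ℂ,
        (∀ m : Module.Dual ℤ N, ∀ q : ℂ, 0 < ‖q‖ → ‖q‖ < ε →
          HasSum (fun k : ℕ => PowerSeries.coeff k (a m) * q ^ k) (ToricForm.rTerm Δ deg q m)) ∧
        ∀ k : ℕ, {m : Module.Dual ℤ N | PowerSeries.coeff k (a m) ≠ 0}.Finite) ∧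
    -- independence of the fan
    (∀ Δ' : Finset (Set (ℝ ⊗[ℤ] N)), ToricForm.IsAdmissible Δ' deg →
      ∃ δ : ℝ, 0 < δ ∧ ∀ q : ℂ, 0 < ‖q‖ → ‖q‖ < δ →
        (∀ m : Module.Dual ℤ N, ToricForm.rTerm Δ deg q m = ToricForm.rTerm Δ' deg q m) ∧
        ToricForm.toricForm Δ deg q = ToricForm.toricForm Δ' deg q) := by
  let b := Module.Free.chooseBasis ℤ N
  obtain ⟨ε, K, L, a, hε, hreg, hconv, hbound, hord⟩ := ToricForm.exists_expansion hΔ b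
  have hinj : Function.Injective fun (m : Module.Dual ℤ N) i => m (b i) := fun m m' h =>
    b.ext (congrFun h)
  have hsum : Summable fun m : Module.Dual ℤ N => K * (1 / 2 : ℝ) ^ ∑ i, (m (b i)).natAbs :=
    ((ToricForm.summable_half_pow_l1 _).comp_injective hinj).mul_left K
  refine ⟨⟨ε, hε, fun C hC q hq0 hq m => ?_, fun q hq0 hq => ?_, ?_, a,
    fun m q hq0 hq => (hconv q hq0 hq m).2, fun k => ?_⟩, fun Δ' hΔ' => ?_⟩
  · obtain ⟨R, hR⟩ := ToricForm.exists_numerator_cone hΔ.1 hΔ.2.1 hC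
    have hiff := ToricForm.isContinuedValue_iff hΔ.1 hΔ.2.1 hC hR (hreg q hq0 hq) m
    exact ⟨_, (hiff _).2 rfl, fun v hv => (hiff v).1 hv⟩
  · exact Summable.of_nonneg_of_le (fun _ => norm_nonneg _) (hbound q hq0 hq) hsum
  · exact HasSumUniformlyOn.of_norm_le_summable hsum fun m q hq => hbound q hq.1 hq.2 m
  · have hfin : (Set.Icc (fun _ => -((L * k : ℕ) : ℤ)) (fun _ => ((L * k : ℕ) : ℤ)) :
        Set (Module.Free.ChooseBasisIndex ℤ N → ℤ)).Finite := Set.finite_Icc _ _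
    refine (hfin.preimage hinj.injOn).subset fun m hm => ?_
    have h1 : ∀ i, (m (b i)).natAbs ≤ L * k := fun i =>
      (Finset.single_le_sum (f := fun i => (m (b i)).natAbs) (fun _ _ => Nat.zero_le _)
        (Finset.mem_univ i)).trans (hord m k hm)
    exact ⟨fun i => by have := h1 i; simp only; omega, fun i => by have := h1 i; simp only; omega⟩
  · obtain ⟨ε', -, -, -, hε', hreg', -⟩ := ToricForm.exists_expansion hΔ' b
    refine ⟨min ε ε', lt_min hε hε', fun q hq0 hq => ?_⟩
    have heq : ∀ m, ToricForm.rTerm Δ deg q m = ToricForm.rTerm Δ' deg q m :=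
      ToricForm.rTerm_eq_rTerm hΔ hΔ' (hreg q hq0 (hq.trans_le (min_le_left _ _)))
        (hreg' q hq0 (hq.trans_le (min_le_right _ _)))
    exact ⟨heq, tsum_congr heq⟩
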